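/- Let $M$ be a smooth ($C^\infty$) connected manifold without boundary, not necessarily compact, and let $N_1$, $N_2$ be smooth closed connected manifolds, of arbitrary dimensions (no orientations are needed). Choose base points $y_1\in N_1$, $y_2\in N_2$, $x_0\in M$, and let $f_i\colon N_i\to M$, $i=1,2$, be smooth maps with $f_i(y_i)=x_0$. Let $\mathcal N_i$ be the path component of $f_i$ in the space $C^\infty(N_i,M)$ of smooth maps with the $C^\infty$ topology. Let $$\mathcal B=\{(\phi_1,\phi_2,\rho_1,\rho_2)\in\mathcal N_1\times\mathcal N_2\times N_1\times N_2 \;:\; \phi_1(\rho_1)=\phi_2(\rho_2)\}$$ with the subspace topology. The group $\pi_1(M,x_0)$ acts on the set $[N_i,M]_\bullet$ of pointed homotopy classes of continuous pointed maps: $\alpha\cdot[f]=[g]$ if there is a free homotopy from $f$ to $g$ along which the base point $y_i$ traces a loop in the class $\alpha$. Let $S_{f_i}=\{\alpha\in\pi_1(M,x_0) : \alpha\cdot[f_i]=[f_i]\}$ be the stabilizer of $[f_i]$, and let $G_i$ be the subgroup of $\pi_1(M,x_0)$ generated by $S_{f_i}$ and $f_{i*}(\pi_1(N_i,y_i))$.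 If the set of double cosets $$G_2\backslash\pi_1(M,x_0)/G_1$$ is infinite, then the set $\pi_0(\mathcal B)$ of path components is infinite, and the $0$-dimensional oriented bordism group $\Omega_0(\mathcal B)$ (bordism classes of maps of closed oriented $0$-manifolds to $\mathcal B$, bordisms being maps of compact oriented $1$-manifolds to $\mathcal B$) is not a finitely generated abelian group. -/

import Mathlib

open Set Topology
open scoped Manifold ContDiff

noncomputable section

/-! ### The `C^∞` topology on spaces of smooth maps -/

section SmoothMaps

variable {n m : ℕ}
  {N : Type*} [TopologicalSpace N] [ChartedSpace (EuclideanSpace ℝ (Fin n)) N]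
  {M : Type*} [TopologicalSpace M] [ChartedSpace (EuclideanSpace ℝ (Fin m)) M]

/-- The basic neighbourhood `𝒩^r(f; φ, ψ, K, ε)` of a smooth map `f : N → M`: all smooth `g` with
`g(K) ⊆ dom ψ` such that, over the points of `K`, the local representatives `ψ ∘ g ∘ φ⁻¹` and
`ψ ∘ f ∘ φ⁻¹` and all their derivatives up to order `r` are `ε`-close. -/
def smoothNhd (f : C^∞⟮𝓡 n, N; 𝓡 m, M⟯)
    (φ : OpenPartialHomeomorph N (EuclideanSpace ℝ (Fin n)))
    (ψ : OpenPartialHomeomorph M (EuclideanSpace ℝ (Fin m)))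
    (K : Set N) (r : ℕ) (ε : ℝ) : Set C^∞⟮𝓡 n, N; 𝓡 m, M⟯ :=
  {g | MapsTo g K ψ.source ∧ ∀ j ≤ r, ∀ x ∈ K,
    ‖iteratedFDeriv ℝ j (ψ ∘ g ∘ φ.symm) (φ x) - iteratedFDeriv ℝ j (ψ ∘ f ∘ φ.symm) (φ x)‖ < ε}

/-- The `C^∞` (compact-open) topology on the space of smooth maps `N → M`, generated by the sets
`𝒩^r(f; φ, ψ, K, ε)` where `φ`, `ψ` are smooth charts, `K ⊆ dom φ` is compact, `f(K) ⊆ dom ψ`,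
`r` is a natural number and `ε > 0`. -/
instance smoothMapTopology : TopologicalSpace C^∞⟮𝓡 n, N; 𝓡 m, M⟯ :=
  TopologicalSpace.generateFrom
    {S | ∃ (f : C^∞⟮𝓡 n, N; 𝓡 m, M⟯)
        (φ : OpenPartialHomeomorph N (EuclideanSpace ℝ (Fin n)))
        (ψ : OpenPartialHomeomorph M (EuclideanSpace ℝ (Fin m)))
        (K : Set N) (r : ℕ) (ε : ℝ),
      φ ∈ IsManifold.maximalAtlas (𝓡 n) ∞ N ∧ ψ ∈ IsManifold.maximalAtlas (𝓡 m) ∞ M ∧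
      IsCompact K ∧ K ⊆ φ.source ∧ MapsTo f K ψ.source ∧ 0 < ε ∧ S = smoothNhd f φ ψ K r ε}

/-- The underlying continuous map of a smooth map. -/
def smoothToContinuous (f : C^∞⟮𝓡 n, N; 𝓡 m, M⟯) : C(N, M) :=
  ⟨f, f.contMDiff.continuous⟩

end SmoothMaps

/-- The space `𝓑` of quadruples `(φ₁, φ₂, ρ₁, ρ₂)` with `φᵢ ∈ 𝒩ᵢ`, `ρᵢ ∈ Nᵢ` and
`φ₁(ρ₁) = φ₂(ρ₂)`. As a type it carries the subspace topology of the product. -/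
def incidenceSpace {n₁ n₂ m : ℕ}
    {N₁ : Type*} [TopologicalSpace N₁] [ChartedSpace (EuclideanSpace ℝ (Fin n₁)) N₁]
    {N₂ : Type*} [TopologicalSpace N₂] [ChartedSpace (EuclideanSpace ℝ (Fin n₂)) N₂]
    {M : Type*} [TopologicalSpace M] [ChartedSpace (EuclideanSpace ℝ (Fin m)) M]
    (𝒩₁ : Set C^∞⟮𝓡 n₁, N₁; 𝓡 m, M⟯) (𝒩₂ : Set C^∞⟮𝓡 n₂, N₂; 𝓡 m, M⟯) :
    Set (C^∞⟮𝓡 n₁, N₁; 𝓡 m, M⟯ × C^∞⟮𝓡 n₂, N₂; 𝓡 m, M⟯ × N₁ × N₂) :=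
  {b | b.1 ∈ 𝒩₁ ∧ b.2.1 ∈ 𝒩₂ ∧ b.1 b.2.2.1 = b.2.1 b.2.2.2}

/-! ### The action of the fundamental group on pointed homotopy classes -/

section Action

variable {X Y : Type*} [TopologicalSpace X] [TopologicalSpace Y]

/-- For pointed maps `f, g : (X, x₀) → (Y, y₀)` and `α ∈ π₁(Y, y₀)`, the relation `α · [f] = [g]`
in the set `[X, Y]•` of pointed homotopy classes: there is a free homotopy from `f` to `g` along
which the base point `x₀` traces a loop in the class `α`. -/
def ActsTo {x₀ : X} {y₀ : Y} (α : FundamentalGroup Y y₀) (f g : C(X, Y))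
    (hf : f x₀ = y₀) (hg : g x₀ = y₀) : Prop :=
  ∃ H : f.Homotopy g,
    FundamentalGroup.fromPath
      (Path.Homotopic.Quotient.mk ((H.evalAt x₀).cast hf.symm hg.symm)) = α

/-- The stabilizer `S_f = {α ∈ π₁(Y, y₀) | α · [f] = [f]}`. -/
def pointedStabilizer {x₀ : X} {y₀ : Y} (f : C(X, Y)) (hf : f x₀ = y₀) :
    Set (FundamentalGroup Y y₀) :=
  {α | ActsTo α f f hf hf}

/-- The subgroup of `π₁(Y, y₀)` generated by `S_f` and `f_* π₁(X, x₀)`. -/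
def stabilizerImageSubgroup {x₀ : X} {y₀ : Y} (f : C(X, Y)) (hf : f x₀ = y₀) :
    Subgroup (FundamentalGroup Y y₀) :=
  Subgroup.closure (pointedStabilizer f hf ∪ range (FundamentalGroup.mapOfEq f hf))

end Action

/-! ### The zero-dimensional oriented bordism group -/

section Bordism

/-- A singular oriented `1`-manifold with boundary in `X`: a compact smooth `1`-manifold with
boundary (not necessarily connected, possibly empty), with an orientation given by a continuous
nowhere vanishing tangent vector field `v`, and a continuous map to `X`. -/
structure SingularArcs (X : Type*) [TopologicalSpace X] where
  W : Type
  [topW : TopologicalSpace W]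
  [chartedW : ChartedSpace (EuclideanHalfSpace 1) W]
  [manifoldW : IsManifold (𝓡∂ 1) ∞ W]
  [compactW : CompactSpace W]
  [t2W : T2Space W]
  v : ∀ p : W, TangentSpace (𝓡∂ 1) p
  v_ne_zero : ∀ p, v p ≠ 0
  v_continuous : Continuous (fun p ↦ (⟨p, v p⟩ : TangentBundle (𝓡∂ 1) W))
  g : C(W, X)

attribute [instance] SingularArcs.topW SingularArcs.chartedW SingularArcs.manifoldW
  SingularArcs.compactW SingularArcs.t2W

variable {X : Type*} [TopologicalSpace X]

/-- The coordinate of the orienting vector `v p` in the preferred half-line chart `[0, ∞)` at `p`.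
(The tangent space at `p` is by definition `ℝ¹`, identified through this chart.) -/
def SingularArcs.coord (A : SingularArcs X) (p : A.W) : ℝ :=
  (show EuclideanSpace ℝ (Fin 1) from A.v p) 0

/-- The sign of a boundary point `p` in the oriented boundary: `+1` if the orienting vector points
out of the manifold, `-1` if it points into it. -/
def SingularArcs.boundarySign (A : SingularArcs X) (p : A.W) : ℤˣ :=
  if A.coord p < 0 then 1 else -1

/-- A closed oriented `0`-manifold with a map to `X` is, up to orientation preserving
diffeomorphism over `X`, a finite multiset of points of `X` with signs. -/
abbrev SignedPoints (X : Type*) := Multiset (X × ℤˣ)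

/-- Orientation reversal. -/
def reverseSigns {X : Type*} : SignedPoints X →+ SignedPoints X :=
  Multiset.mapAddMonoidHom (fun q ↦ (q.1, -q.2))

/-- `s` and `t` are bordant: there is a singular compact oriented `1`-manifold in `X` whose oriented
boundary is the disjoint union of `s` and of `t` with reversed orientation. -/
def Bordant (s t : SignedPoints X) : Prop :=
  ∃ (A : SingularArcs X) (D : Finset A.W), (D : Set A.W) = (𝓡∂ 1).boundary A.W ∧
    D.val.map (fun p ↦ (A.g p, A.boundarySign p)) = s + reverseSigns t

/-- The congruence (with respect to disjoint union) generated by bordism. Bordism is an equivalence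
relation compatible with disjoint unions, so this congruence is bordism itself. -/
def bordismCon (X : Type*) [TopologicalSpace X] : AddCon (SignedPoints X) :=
  addConGen Bordant

/-- The oriented bordism group `Ω₀(X)`: bordism classes of closed oriented `0`-manifolds mapped to
`X`, with addition induced by disjoint union. -/
def BordismZero (X : Type*) [TopologicalSpace X] : Type _ :=
  (bordismCon X).Quotient

instance BordismZero.instAddCommMonoid : AddCommMonoid (BordismZero X) :=
  inferInstanceAs (AddCommMonoid (bordismCon X).Quotient)

lemma reverseSigns_reverseSigns {X : Type*} (s : SignedPoints X) : reverseSigns (reverseSigns s) = s := by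
  simp [reverseSigns, Multiset.map_map]

/-- The same singular manifold with the opposite orientation. -/
def SingularArcs.reverse (A : SingularArcs X) : SingularArcs X where
  W := A.W
  v := fun p ↦ -A.v p
  v_ne_zero := fun p ↦ neg_ne_zero.mpr (A.v_ne_zero p)
  v_continuous := by
    have h := A.v_continuous
    rw [continuous_iff_continuousAt] at h ⊢
    intro p
    have h1 := (FiberBundle.continuousAt_totalSpace (EuclideanSpace ℝ (Fin 1)) _).1 (h p)
    refine (FiberBundle.continuousAt_totalSpace (EuclideanSpace ℝ (Fin 1)) _).2 ⟨h1.1, ?_⟩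
    refine (h1.2.neg).congr ?_
    have hb : ∀ᶠ q in 𝓝 p, q ∈ (trivializationAt (EuclideanSpace ℝ (Fin 1))
        (TangentSpace (𝓡∂ 1) : A.W → Type) p).baseSet :=
      (trivializationAt (EuclideanSpace ℝ (Fin 1))
        (TangentSpace (𝓡∂ 1) : A.W → Type) p).open_baseSet.mem_nhds
        (FiberBundle.mem_baseSet_trivializationAt' p)
    filter_upwards [hb] with q hq
    have := (trivializationAt (EuclideanSpace ℝ (Fin 1))
        (TangentSpace (𝓡∂ 1) : A.W → Type) p).linear ℝ hq
    exact (this.map_neg _).symm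
  g := A.g

lemma SingularArcs.coord_ne_zero (A : SingularArcs X) (p : A.W) : A.coord p ≠ 0 := by
  intro h
  apply A.v_ne_zero p
  change (show EuclideanSpace ℝ (Fin 1) from A.v p) = 0
  ext i
  rw [Subsingleton.elim i 0]
  exact h

lemma SingularArcs.boundarySign_reverse (A : SingularArcs X) (p : A.W) :
    A.reverse.boundarySign p = -A.boundarySign p := by
  have hc : A.reverse.coord p = -A.coord p := rfl
  have := A.coord_ne_zero p
  unfold SingularArcs.boundarySign
  rw [hc]
  rcases lt_or_gt_of_ne this with h | h
  · rw [if_neg (by linarith), if_pos h]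
  · rw [if_pos (by linarith), if_neg (by linarith)]
    simp

lemma Bordant.reverse {s t : SignedPoints X} (h : Bordant s t) :
    Bordant (reverseSigns s) (reverseSigns t) := by
  obtain ⟨A, D, hD, hs⟩ := h
  refine ⟨A.reverse, D, hD, ?_⟩
  rw [← map_add, ← hs]
  change _ = Multiset.map _ _
  rw [Multiset.map_map]
  refine Multiset.map_congr rfl fun p _ ↦ ?_
  exact Prod.ext rfl (A.boundarySign_reverse p)

/-- The interval `[0, 1]` mapped to a point, oriented by the unit tangent vector. -/
def constantArc (x : X) : SingularArcs X where
  W := Icc (0 : ℝ) 1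
  v := fun p ↦ oneTangentSpaceIcc p
  v_ne_zero := by
    intro p hp
    have h1 := mfderiv_subtypeVal_Icc_one p
    have h2 : (1 : TangentSpace (𝓡∂ 1) p) = 0 := hp
    rw [h2, map_zero] at h1
    exact zero_ne_one (α := ℝ) h1
  v_continuous := by
    have hU : UniqueMDiffOn 𝓘(ℝ) (Icc (0 : ℝ) 1) :=
      (uniqueDiffOn_Icc zero_lt_one).uniqueMDiffOn
    have h := (contMDiffOn_projIcc (x := (0 : ℝ)) (y := 1) (n := 1)).continuousOn_tangentMapWithin
      le_rfl hU
    have hc : Continuous (fun p : Icc (0 : ℝ) 1 ↦ (⟨p, (1 : ℝ)⟩ : TangentBundle 𝓘(ℝ) ℝ)) := by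
      have := (tangentBundleModelSpaceHomeomorph 𝓘(ℝ)).symm.continuous.comp
        (continuous_subtype_val.prodMk continuous_const :
          Continuous fun p : Icc (0 : ℝ) 1 ↦ ((p : ℝ), (1 : ℝ)))
      exact this
    refine (h.comp_continuous hc (fun p ↦ p.2)).congr ?_
    intro p
    have hp : projIcc (0 : ℝ) 1 zero_le_one p = p := projIcc_val _ p
    rw [oneTangentSpaceIcc]
    exact Bundle.TotalSpace.ext hp HEq.rfl
  g := ContinuousMap.const _ x

lemma constantArc_coord (x : X) (p : Icc (0 : ℝ) 1) (c : ℝ) (F : ℝ → ℝ)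
    (hF : HasDerivAt F c p)
    (hc : ∀ w ∈ Icc (0 : ℝ) 1,
      (extChartAt (𝓡∂ 1) p (projIcc (0 : ℝ) 1 zero_le_one w)) 0 = F w) :
    (constantArc x).coord p = c := by
  have hp : projIcc (0 : ℝ) 1 zero_le_one p = p := projIcc_val _ p
  have hd : MDifferentiableWithinAt 𝓘(ℝ) (𝓡∂ 1) (projIcc (0 : ℝ) 1 zero_le_one)
      (Icc (0 : ℝ) 1) p :=
    (contMDiffOn_projIcc (x := (0 : ℝ)) (y := 1) (n := 1) _ p.2).mdifferentiableWithinAt one_ne_zero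
  change (show EuclideanSpace ℝ (Fin 1) from oneTangentSpaceIcc p) 0 = c
  rw [oneTangentSpaceIcc]
  have hG := hd.hasMFDerivWithinAt.2
  have hG' : HasFDerivWithinAt (fun w : ℝ ↦ extChartAt (𝓡∂ 1) p
      (projIcc (0 : ℝ) 1 zero_le_one w)) (mfderivWithin 𝓘(ℝ) (𝓡∂ 1)
        (projIcc (0 : ℝ) 1 zero_le_one) (Icc (0 : ℝ) 1) p : ℝ →L[ℝ] EuclideanSpace ℝ (Fin 1))
      (Icc (0 : ℝ) 1) (p : ℝ) := by
    simpa [writtenInExtChartAt, hp] using! hG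
  have h0 := ((EuclideanSpace.proj (𝕜 := ℝ) (0 : Fin 1)).hasFDerivAt.comp_hasFDerivWithinAt
    (p : ℝ) hG').hasDerivWithinAt
  have h1 : HasDerivWithinAt F c (Icc (0 : ℝ) 1) p := hF.hasDerivWithinAt
  have h2 := h1.congr_of_mem hc p.2
  exact (uniqueDiffOn_Icc zero_lt_one _ p.2).eq_deriv _ h0 h2

lemma constantArc_sign_bot (x : X) : (constantArc x).boundarySign (⊥ : Icc (0 : ℝ) 1) = -1 := by
  have h : (constantArc x).coord (⊥ : Icc (0 : ℝ) 1) = 1 := by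
    refine constantArc_coord x _ 1 (fun w ↦ w) (hasDerivAt_id _) ?_
    intro w hw
    simp [extChartAt, modelWithCornersEuclideanHalfSpace, IccLeftChart,
      projIcc_of_mem zero_le_one hw]
  exact if_neg (by rw [h]; norm_num)

lemma constantArc_sign_top (x : X) : (constantArc x).boundarySign (⊤ : Icc (0 : ℝ) 1) = 1 := by
  have h : (constantArc x).coord (⊤ : Icc (0 : ℝ) 1) = -1 := by
    refine constantArc_coord x _ (-1) (fun w ↦ 1 - w) ((hasDerivAt_id _).const_sub 1) ?_
    intro w hw
    simp [extChartAt, modelWithCornersEuclideanHalfSpace, IccRightChart,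
      projIcc_of_mem zero_le_one hw]
  exact if_pos (by rw [h]; norm_num)

/-- A point together with the same point with the opposite sign bounds an interval. -/
lemma bordant_cancel (x : X) : Bordant ({(x, -1)} + {(x, 1)}) 0 := by
  classical
  refine ⟨constantArc x, ({⊥, ⊤} : Finset (Icc (0 : ℝ) 1)), ?_, ?_⟩
  · exact (Finset.coe_pair (a := (⊥ : Icc (0 : ℝ) 1)) (b := ⊤)).trans boundary_Icc.symm
  · have hv : ({⊥, ⊤} : Finset (Icc (0 : ℝ) 1)).val = ⊥ ::ₘ {⊤} := by
      rw [Finset.insert_val_of_notMem (by simp)]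
      rfl
    rw [map_zero, add_zero]
    refine (congrArg (Multiset.map _) hv).trans ?_
    change (x, (constantArc x).boundarySign (⊥ : Icc (0 : ℝ) 1)) ::ₘ
      (x, (constantArc x).boundarySign (⊤ : Icc (0 : ℝ) 1)) ::ₘ 0 = _
    refine (congrArg₂ (fun a b ↦ (x, a) ::ₘ (x, b) ::ₘ (0 : SignedPoints X))
      (constantArc_sign_bot x) (constantArc_sign_top x)).trans ?_
    rfl

/-- The inverse in `Ω₀(X)` is given by orientation reversal. -/
instance BordismZero.instNeg : Neg (BordismZero X) where
  neg := AddCon.lift (bordismCon X) ((bordismCon X).mk'.comp reverseSigns) (by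
    refine AddCon.addConGen_le.2 fun s t h ↦ ?_
    exact (AddCon.eq _).2 (AddConGen.Rel.of _ _ h.reverse))

instance BordismZero.instAddCommGroup : AddCommGroup (BordismZero X) where
  zsmul := zsmulRec
  neg_add_cancel := by
    intro a
    induction a using AddCon.induction_on with | _ s
    change ((reverseSigns s : SignedPoints X) : (bordismCon X).Quotient) + s = 0
    rw [← AddCon.coe_add, ← AddCon.coe_zero, AddCon.eq]
    induction s using Multiset.induction_on with
    | empty => exact (bordismCon X).refl _
    | cons q s ih =>
      have hq : bordismCon X (reverseSigns {q} + {q}) 0 := by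
        obtain ⟨x, ε⟩ := q
        have h0 : bordismCon X ({(x, -1)} + {(x, 1)}) 0 := AddConGen.Rel.of _ _ (bordant_cancel x)
        rcases Int.units_eq_one_or ε with rfl | rfl
        · exact h0
        · rw [add_comm] at h0
          simpa [reverseSigns] using h0
      have h := (bordismCon X).add hq ih
      have e : reverseSigns (q ::ₘ s) + q ::ₘ s =
          reverseSigns {q} + {q} + (reverseSigns s + s) := by
        rw [← Multiset.singleton_add, map_add]
        abel
      rw [e]
      simpa using h

end Bordism

end

/-!
A point `(φ₁, φ₂, ρ₁, ρ₂)` of the incidence space determines a double coset of `π₁(M, x₀)`: join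
`fᵢ` to `φᵢ` by a path `γᵢ` of smooth maps and `yᵢ` to `ρᵢ` by a path `ηᵢ`. The two tracks
`cᵢ : s ↦ γᵢ s (ηᵢ s)` run from `x₀` to the common value `φ₁(ρ₁) = φ₂(ρ₂)`, and `c₁ c₂⁻¹` is a loop
at `x₀` (`Represents`). Another choice of `γᵢ` and `ηᵢ` changes `cᵢ` by a loop of the form
`s ↦ γ s (η s)`, where `γ` is a loop at `fᵢ` and `η` a loop at `yᵢ`. Such a loop is the product of an
element of the stabilizer of `[fᵢ]` and of an element of the image of `π₁(Nᵢ, yᵢ)`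
(`IsTrack.mem_stabilizerImageSubgroup`). Along a path in the incidence space both tracks are
prolonged by the same path (`Represents.of_joined`). This gives a map from the set of path components
to the set of double cosets. It is surjective, because every loop at `x₀` is, up to homotopy, the
track of `y₁` under a path of smooth maps starting at `f₁` (`exists_path_smoothMap`): inside a chart
ball a point is pushed to another one by the maps `x ↦ x + t β(x) v`, with `β` a bump
function, and connectedness of `[0, 1]` carries this along the whole loop. Hence there are
infinitely many path components.

The bordism group `Ω₀(X)` maps onto the free abelian group on the path components of `X` by counting
points with signs. That bordant `0`-manifolds have equal counts says that in every clopen part of a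
compact oriented `1`-manifold the signs of the boundary points add up to `0`. Instead of the
classification of `1`-manifolds, the proof uses Stokes' theorem
(`SingularArcs.sum_boundarySign_mul_of_isLocallyConstant`): for a smooth function `f` supported in
one chart, the signed sum of `f` over the boundary is the integral of `df` over that chart by the
fundamental theorem of calculus. For a partition of unity `ρ` subordinate to the charts and a
locally constant `χ`, the sum over `i` of the integrals of `d(ρᵢ χ) = ∑ⱼ ρⱼ d(ρᵢ χ)` can be
rearranged, by change of variables on the overlaps, into the sum over `j` of the integrals of
`ρⱼ d(∑ᵢ ρᵢ χ) = ρⱼ dχ = 0`.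
-/

noncomputable section

namespace SingularArcs

open MeasureTheory Filter

variable {X : Type*} [TopologicalSpace X] (A : SingularArcs X)

/-! ### Calculus in the charts of an oriented 1-manifold -/

/-- The derivative `df(v)` of a real function `f` along the orienting vector field `v`. -/
def lieDeriv (f : A.W → ℝ) (p : A.W) : ℝ :=
  (show ℝ from mfderiv (𝓡∂ 1) 𝓘(ℝ, ℝ) f p (A.v p))

/-- The real coordinate of the preferred chart at `i`. -/
def chartCoord (i p : A.W) : ℝ := (extChartAt (𝓡∂ 1) i p) 0

/-- The inverse of the coordinate `chartCoord i`, meaningful on `chartRange i`. -/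
def chartParam (i : A.W) (x : ℝ) : A.W :=
  (extChartAt (𝓡∂ 1) i).symm (EuclideanSpace.single 0 x)

/-- The set of values of the coordinate `chartCoord i`, a relatively open subset of `[0, ∞)`. -/
def chartRange (i : A.W) : Set ℝ :=
  {x | EuclideanSpace.single 0 x ∈ (extChartAt (𝓡∂ 1) i).target}

/-- The velocity of the coordinate `chartCoord i` along the orienting vector field. -/
def speed (i p : A.W) : ℝ := A.lieDeriv (A.chartCoord i) p

lemma single_apply_zero (w : EuclideanSpace ℝ (Fin 1)) : EuclideanSpace.single 0 (w 0) = w := by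
  ext j
  rw [Subsingleton.elim j 0]
  simp

lemma single_chartCoord (i p : A.W) :
    EuclideanSpace.single 0 (A.chartCoord i p) = extChartAt (𝓡∂ 1) i p :=
  single_apply_zero _

lemma chartCoord_mem {i p : A.W} (hp : p ∈ (chartAt (EuclideanHalfSpace 1) i).source) :
    A.chartCoord i p ∈ A.chartRange i := by
  rw [← extChartAt_source (𝓡∂ 1)] at hp
  change EuclideanSpace.single 0 (A.chartCoord i p) ∈ (extChartAt (𝓡∂ 1) i).target
  rw [single_chartCoord]
  exact (extChartAt (𝓡∂ 1) i).map_source hp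

lemma chartParam_chartCoord {i p : A.W} (hp : p ∈ (chartAt (EuclideanHalfSpace 1) i).source) :
    A.chartParam i (A.chartCoord i p) = p := by
  rw [← extChartAt_source (𝓡∂ 1)] at hp
  rw [chartParam, single_chartCoord]
  exact (extChartAt (𝓡∂ 1) i).left_inv hp

lemma chartParam_mem {i : A.W} {x : ℝ} (hx : x ∈ A.chartRange i) :
    A.chartParam i x ∈ (chartAt (EuclideanHalfSpace 1) i).source := by
  rw [← extChartAt_source (𝓡∂ 1)]
  exact (extChartAt (𝓡∂ 1) i).map_target hx

lemma chartCoord_chartParam {i : A.W} {x : ℝ} (hx : x ∈ A.chartRange i) :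
    A.chartCoord i (A.chartParam i x) = x := by
  rw [chartCoord, chartParam, (extChartAt (𝓡∂ 1) i).right_inv hx]
  simp

lemma chartRange_subset (i : A.W) : A.chartRange i ⊆ Ici 0 := by
  intro x hx
  have := extChartAt_target_subset_range i hx
  rw [range_modelWithCornersEuclideanHalfSpace] at this
  simpa using this

lemma chartRange_mem_nhdsWithin {i : A.W} {x : ℝ} (hx : x ∈ A.chartRange i) :
    A.chartRange i ∈ 𝓝[Ici 0] x := by
  have h := extChartAt_target_mem_nhdsWithin_of_mem hx
  have hc : Continuous (fun y : ℝ ↦ EuclideanSpace.single (0 : Fin 1) y) :=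
    (PiLp.continuous_toLp 2 _).comp (continuous_single (A := fun _ : Fin 1 ↦ ℝ) 0)
  have ht : Tendsto (fun y : ℝ ↦ EuclideanSpace.single (0 : Fin 1) y) (𝓝[Ici 0] x)
      (𝓝[range (𝓡∂ 1)] (EuclideanSpace.single (0 : Fin 1) x)) := by
    refine tendsto_nhdsWithin_iff.2 ⟨hc.continuousAt.mono_left nhdsWithin_le_nhds, ?_⟩
    filter_upwards [self_mem_nhdsWithin] with y hy
    rw [range_modelWithCornersEuclideanHalfSpace]
    simpa using hy
  exact ht h

lemma mdifferentiableAt_chartCoord {i p : A.W}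
    (hp : p ∈ (chartAt (EuclideanHalfSpace 1) i).source) :
    MDifferentiableAt (𝓡∂ 1) 𝓘(ℝ, ℝ) (A.chartCoord i) p := by
  have h : MDifferentiableAt (𝓡∂ 1) 𝓘(ℝ, EuclideanSpace ℝ (Fin 1)) (extChartAt (𝓡∂ 1) i) p :=
    mdifferentiableAt_extChartAt hp
  have h2 := ((EuclideanSpace.proj (𝕜 := ℝ) (0 : Fin 1)).hasFDerivAt
    (x := extChartAt (𝓡∂ 1) i p)).hasMFDerivAt.mdifferentiableAt
  exact h2.comp p h

lemma speed_eq {i p : A.W} (hp : p ∈ (chartAt (EuclideanHalfSpace 1) i).source) :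
    A.speed i p = (show EuclideanSpace ℝ (Fin 1) from
      mfderiv (𝓡∂ 1) 𝓘(ℝ, EuclideanSpace ℝ (Fin 1)) (extChartAt (𝓡∂ 1) i) p (A.v p)) 0 := by
  have h : MDifferentiableAt (𝓡∂ 1) 𝓘(ℝ, EuclideanSpace ℝ (Fin 1)) (extChartAt (𝓡∂ 1) i) p :=
    mdifferentiableAt_extChartAt hp
  have h2 := ((EuclideanSpace.proj (𝕜 := ℝ) (0 : Fin 1)).hasFDerivAt
    (x := extChartAt (𝓡∂ 1) i p)).hasMFDerivAt
  have h3 := (h2.comp p h.hasMFDerivAt).mfderiv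
  exact congrArg (fun T ↦ T (A.v p)) h3

lemma speed_self (p : A.W) : A.speed p p = A.coord p := by
  rw [speed_eq _ (mem_chart_source _ p), mfderiv_extChartAt_self]
  rfl

/-- The chart parametrisation is an integral curve of the orienting field up to the factor given
by the speed of the coordinate. -/
lemma hasMFDerivWithinAt_chartParam {i p : A.W}
    (hp : p ∈ (chartAt (EuclideanHalfSpace 1) i).source) :
    ∃ T : ℝ →L[ℝ] EuclideanSpace ℝ (Fin 1),
      HasMFDerivWithinAt 𝓘(ℝ, ℝ) (𝓡∂ 1) (A.chartParam i) (Ici 0) (A.chartCoord i p) T ∧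
      A.speed i p • T 1 = A.v p := by
  have hs : p ∈ (extChartAt (𝓡∂ 1) i).source := by rwa [extChartAt_source]
  have hinv := mfderivWithin_extChartAt_symm_comp_mfderiv_extChartAt' hs
  have h1 := (mdifferentiableWithinAt_extChartAt_symm
    ((extChartAt (𝓡∂ 1) i).map_source hs)).hasMFDerivWithinAt
  set S : EuclideanSpace ℝ (Fin 1) →L[ℝ] EuclideanSpace ℝ (Fin 1) :=
    mfderivWithin 𝓘(ℝ, EuclideanSpace ℝ (Fin 1)) (𝓡∂ 1) (extChartAt (𝓡∂ 1) i).symm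
      (range (𝓡∂ 1)) (extChartAt (𝓡∂ 1) i p) with hS
  let ι : ℝ →L[ℝ] EuclideanSpace ℝ (Fin 1) :=
    ContinuousLinearMap.toSpanSingleton ℝ (EuclideanSpace.single 0 1)
  have hι : ∀ x, ι x = EuclideanSpace.single 0 x := by
    intro x
    ext j
    rw [Subsingleton.elim j 0]
    simp [ι]
  refine ⟨S.comp ι, ?_, ?_⟩
  · have h2 : HasMFDerivWithinAt 𝓘(ℝ, ℝ) 𝓘(ℝ, EuclideanSpace ℝ (Fin 1)) ι (Ici 0)
        (A.chartCoord i p) ι :=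
      ι.hasFDerivAt.hasMFDerivAt.hasMFDerivWithinAt
    have e : ι (A.chartCoord i p) = extChartAt (𝓡∂ 1) i p := by
      rw [hι, single_chartCoord]
    have hm : Ici (0 : ℝ) ⊆ ι ⁻¹' range (𝓡∂ 1) := by
      intro y hy
      rw [mem_preimage, range_modelWithCornersEuclideanHalfSpace, hι]
      simpa using hy
    rw [← e] at h1
    have h3 := HasMFDerivWithinAt.comp (A.chartCoord i p) h1 h2 hm
    refine h3.congr_of_eventuallyEq ?_ ?_
    · exact Eventually.of_forall fun y ↦ by simp [chartParam, hι]
    · simp [chartParam, hι]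
  · have h4 := congrArg (fun T ↦ T (A.v p)) hinv
    change S (show EuclideanSpace ℝ (Fin 1) from
      mfderiv (𝓡∂ 1) 𝓘(ℝ, EuclideanSpace ℝ (Fin 1)) (extChartAt (𝓡∂ 1) i) p (A.v p)) = A.v p at h4
    rw [← h4, ContinuousLinearMap.comp_apply, hι, ← map_smul]
    congr 1
    rw [speed_eq _ hp]
    ext j
    rw [Subsingleton.elim j 0]
    simp

lemma speed_ne_zero {i p : A.W} (hp : p ∈ (chartAt (EuclideanHalfSpace 1) i).source) :
    A.speed i p ≠ 0 := by
  intro h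
  obtain ⟨T, -, hT⟩ := A.hasMFDerivWithinAt_chartParam hp
  rw [h, zero_smul] at hT
  exact A.v_ne_zero p hT.symm

/-- The chain rule in a chart: in the coordinate `x` the field is `speed • ∂/∂x`, so that
`df/dx = df(v) / speed`. For `f` another coordinate this computes the coordinate change. -/
lemma hasDerivWithinAt_comp_chartParam {i p : A.W}
    (hp : p ∈ (chartAt (EuclideanHalfSpace 1) i).source) {f : A.W → ℝ}
    (hf : MDifferentiableAt (𝓡∂ 1) 𝓘(ℝ, ℝ) f p) :
    HasDerivWithinAt (f ∘ A.chartParam i) (A.lieDeriv f p / A.speed i p) (Ici 0)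
      (A.chartCoord i p) := by
  obtain ⟨T, hT, hv⟩ := A.hasMFDerivWithinAt_chartParam hp
  have hf' := hf.hasMFDerivAt
  set F : EuclideanSpace ℝ (Fin 1) →L[ℝ] ℝ := mfderiv (𝓡∂ 1) 𝓘(ℝ, ℝ) f p with hF
  rw [← A.chartParam_chartCoord hp] at hf'
  have h : HasFDerivWithinAt (f ∘ A.chartParam i) (F.comp T) (Ici 0) (A.chartCoord i p) :=
    (HasMFDerivAt.comp_hasMFDerivWithinAt (A.chartCoord i p) hf' hT).hasFDerivWithinAt
  have h' := HasFDerivWithinAt.hasDerivWithinAt h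
  refine h'.congr_deriv ?_
  have hne := A.speed_ne_zero hp
  have : A.lieDeriv f p = A.speed i p * F (T 1) := by
    change F (A.v p) = _
    rw [← hv, map_smul, smul_eq_mul]
  rw [this, mul_div_cancel_left₀ _ hne]
  rfl

/-! ### Integration in the charts -/

lemma continuous_lieDeriv {f : A.W → ℝ} (hf : ContMDiff (𝓡∂ 1) 𝓘(ℝ, ℝ) ∞ f) :
    Continuous (A.lieDeriv f) := by
  have h := (hf.continuous_tangentMap (by norm_num)).comp A.v_continuous
  exact continuous_snd.comp ((tangentBundleModelSpaceHomeomorph 𝓘(ℝ, ℝ)).continuous.comp h)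

lemma continuousOn_speed (i : A.W) :
    ContinuousOn (A.speed i) (chartAt (EuclideanHalfSpace 1) i).source := by
  have ho : IsOpen (chartAt (EuclideanHalfSpace 1) i).source := (chartAt _ i).open_source
  have h0 : ContMDiffOn (𝓡∂ 1) 𝓘(ℝ, EuclideanSpace ℝ (Fin 1)) ∞ (extChartAt (𝓡∂ 1) i)
      (chartAt (EuclideanHalfSpace 1) i).source := contMDiffOn_extChartAt
  have h1 : ContMDiffOn (𝓡∂ 1) 𝓘(ℝ, ℝ) ∞ (A.chartCoord i)
      (chartAt (EuclideanHalfSpace 1) i).source :=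
    (EuclideanSpace.proj (𝕜 := ℝ) (0 : Fin 1)).contMDiff.comp_contMDiffOn h0
  have h := (h1.continuousOn_tangentMapWithin (by norm_num) ho.uniqueMDiffOn).comp
    A.v_continuous.continuousOn (s := (chartAt (EuclideanHalfSpace 1) i).source)
    (fun p hp ↦ hp)
  have h2 := continuous_snd.comp_continuousOn
    ((tangentBundleModelSpaceHomeomorph 𝓘(ℝ, ℝ)).continuous.comp_continuousOn h)
  refine h2.congr fun p hp ↦ ?_
  have e := mfderivWithin_of_isOpen (I := 𝓡∂ 1) (I' := 𝓘(ℝ, ℝ)) (f := A.chartCoord i) ho hp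
  exact (congrArg (fun T ↦ T (A.v p)) e).symm

lemma lieDeriv_congr {f g : A.W → ℝ} {p : A.W} (h : f =ᶠ[𝓝 p] g) :
    A.lieDeriv f p = A.lieDeriv g p := by
  rw [lieDeriv, lieDeriv, h.mfderiv_eq]
  rw [h.eq_of_nhds]

lemma lieDeriv_const (c : ℝ) (p : A.W) : A.lieDeriv (fun _ ↦ c) p = 0 := by
  have h : mfderiv (𝓡∂ 1) 𝓘(ℝ, ℝ) (fun _ : A.W ↦ c) p = 0 := mfderiv_const
  exact congrArg (fun T ↦ T (A.v p)) h

lemma lieDeriv_add {f g : A.W → ℝ} {p : A.W} (hf : MDifferentiableAt (𝓡∂ 1) 𝓘(ℝ, ℝ) f p)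
    (hg : MDifferentiableAt (𝓡∂ 1) 𝓘(ℝ, ℝ) g p) :
    A.lieDeriv (f + g) p = A.lieDeriv f p + A.lieDeriv g p :=
  congrArg (fun T ↦ T (A.v p)) (hf.hasMFDerivAt.add hg.hasMFDerivAt).mfderiv

lemma lieDeriv_sum {ι : Type*} (s : Finset ι) (f : ι → A.W → ℝ)
    (hf : ∀ i ∈ s, ContMDiff (𝓡∂ 1) 𝓘(ℝ, ℝ) ∞ (f i)) (p : A.W) :
    A.lieDeriv (fun q ↦ ∑ i ∈ s, f i q) p = ∑ i ∈ s, A.lieDeriv (f i) p := by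
  classical
  induction s using Finset.induction_on with
  | empty => simpa using A.lieDeriv_const 0 p
  | insert a s ha ih =>
    have hs : ContMDiff (𝓡∂ 1) 𝓘(ℝ, ℝ) ∞ (fun q ↦ ∑ i ∈ s, f i q) :=
      contMDiff_finsetSum fun i hi ↦ hf i (Finset.mem_insert_of_mem hi)
    rw [Finset.sum_insert ha, ← ih fun i hi ↦ hf i (Finset.mem_insert_of_mem hi),
      ← A.lieDeriv_add ((hf a (Finset.mem_insert_self _ _)).mdifferentiable (by norm_num) p)
        (hs.mdifferentiable (by norm_num) p)]
    congr 1
    ext q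
    simp [Finset.sum_insert ha]

lemma lieDeriv_eq_zero_of_notMem_tsupport {f : A.W → ℝ} {p : A.W} (hp : p ∉ tsupport f) :
    A.lieDeriv f p = 0 := by
  rw [A.lieDeriv_congr (notMem_tsupport_iff_eventuallyEq.1 hp)]
  exact A.lieDeriv_const 0 p

lemma continuousOn_chartParam (i : A.W) : ContinuousOn (A.chartParam i) (A.chartRange i) := by
  have hc : Continuous (fun y : ℝ ↦ EuclideanSpace.single (0 : Fin 1) y) :=
    (PiLp.continuous_toLp 2 _).comp (continuous_single (A := fun _ : Fin 1 ↦ ℝ) 0)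
  exact (continuousOn_extChartAt_symm i).comp hc.continuousOn fun x hx ↦ hx

lemma measurableSet_chartRange (i : A.W) : MeasurableSet (A.chartRange i) := by
  have hc : Continuous (fun y : ℝ ↦ EuclideanSpace.single (0 : Fin 1) y) :=
    (PiLp.continuous_toLp 2 _).comp (continuous_single (A := fun _ : Fin 1 ↦ ℝ) 0)
  have h : A.chartRange i = (fun y : ℝ ↦ EuclideanSpace.single (0 : Fin 1) y) ⁻¹'
      (((𝓡∂ 1).symm ⁻¹' (chartAt (EuclideanHalfSpace 1) i).target) ∩ range (𝓡∂ 1)) := by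
    rw [← extChartAt_target]
    rfl
  rw [h, preimage_inter]
  refine (((chartAt (EuclideanHalfSpace 1) i).open_target.preimage
    (𝓡∂ 1).continuous_symm).preimage hc).measurableSet.inter ?_
  exact ((𝓡∂ 1).isClosed_range.preimage hc).measurableSet

/-- The part of the range of the coordinate at `i` that lies over the chart at `j`. -/
def chartOverlap (i j : A.W) : Set ℝ :=
  A.chartRange i ∩ A.chartParam i ⁻¹' (chartAt (EuclideanHalfSpace 1) j).source

lemma measurableSet_chartOverlap (i j : A.W) : MeasurableSet (A.chartOverlap i j) := by
  obtain ⟨u, hu, h⟩ := continuousOn_iff'.1 (A.continuousOn_chartParam i) _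
    (chartAt (EuclideanHalfSpace 1) j).open_source
  rw [chartOverlap, inter_comm, h]
  exact hu.measurableSet.inter (A.measurableSet_chartRange i)

lemma image_chartOverlap (i j : A.W) :
    (A.chartCoord j ∘ A.chartParam i) '' A.chartOverlap i j = A.chartOverlap j i := by
  ext y
  constructor
  · rintro ⟨x, ⟨hx, hx'⟩, rfl⟩
    refine ⟨A.chartCoord_mem hx', ?_⟩
    rw [mem_preimage, Function.comp_apply, A.chartParam_chartCoord hx']
    exact A.chartParam_mem hx
  · rintro ⟨hy, hy'⟩
    refine ⟨A.chartCoord i (A.chartParam j y), ⟨A.chartCoord_mem hy', ?_⟩, ?_⟩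
    · rw [mem_preimage, A.chartParam_chartCoord hy']
      exact A.chartParam_mem hy
    · rw [Function.comp_apply, A.chartParam_chartCoord hy', A.chartCoord_chartParam hy]

/-- The integral, over the chart at `i`, of the function `h` against the density that is dual to
the orienting vector field. -/
def chartIntegral (i : A.W) (h : A.W → ℝ) : ℝ :=
  ∫ x in A.chartRange i, h (A.chartParam i x) / |A.speed i (A.chartParam i x)|

/-- Over the overlap of two charts the two chart integrals agree: the velocities of the two
coordinates differ by the derivative of the coordinate change. -/
lemma chartIntegral_eq_of_support {i j : A.W} {h : A.W → ℝ}
    (hi : ∀ p ∉ (chartAt (EuclideanHalfSpace 1) i).source, h p = 0)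
    (hj : ∀ p ∉ (chartAt (EuclideanHalfSpace 1) j).source, h p = 0) :
    A.chartIntegral i h = A.chartIntegral j h := by
  have key : ∀ i j : A.W, (∀ p ∉ (chartAt (EuclideanHalfSpace 1) j).source, h p = 0) →
      A.chartIntegral i h =
        ∫ x in A.chartOverlap i j, h (A.chartParam i x) / |A.speed i (A.chartParam i x)| := by
    intro i j hj
    refine (setIntegral_eq_of_subset_of_forall_sdiff_eq_zero (A.measurableSet_chartRange i)
      inter_subset_left fun x hx ↦ ?_)
    rw [hj _ fun hx' ↦ hx.2 ⟨hx.1, hx'⟩, zero_div]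
  rw [key i j hj, key j i hi, ← A.image_chartOverlap i j]
  rw [integral_image_eq_integral_abs_deriv_smul (A.measurableSet_chartOverlap i j)
    (f' := fun x ↦ A.speed j (A.chartParam i x) / A.speed i (A.chartParam i x))]
  · refine setIntegral_congr_fun (A.measurableSet_chartOverlap i j) fun x hx ↦ ?_
    have h1 := A.speed_ne_zero (A.chartParam_mem hx.1)
    have h2 := A.speed_ne_zero hx.2
    simp only [Function.comp_apply, smul_eq_mul]
    rw [A.chartParam_chartCoord hx.2, abs_div]
    field_simp
  · intro x hx
    have h1 := A.hasDerivWithinAt_comp_chartParam (A.chartParam_mem hx.1)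
      (A.mdifferentiableAt_chartCoord hx.2)
    rw [A.chartCoord_chartParam hx.1] at h1
    exact h1.mono (inter_subset_left.trans (A.chartRange_subset i))
  · intro x hx y hy hxy
    have h1 := A.chartParam_chartCoord hx.2
    rw [show A.chartCoord j (A.chartParam i x) = A.chartCoord j (A.chartParam i y) from hxy,
      A.chartParam_chartCoord hy.2] at h1
    rw [← A.chartCoord_chartParam hx.1, ← h1, A.chartCoord_chartParam hy.1]

lemma isCompact_chartCoord_image {i : A.W} {K : Set A.W} (hK : IsClosed K)
    (hKi : K ⊆ (chartAt (EuclideanHalfSpace 1) i).source) : IsCompact (A.chartCoord i '' K) :=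
  hK.isCompact.image_of_continuousOn fun _ hp ↦
    (A.mdifferentiableAt_chartCoord (hKi hp)).continuousAt.continuousWithinAt

lemma continuousOn_density {i : A.W} {h : A.W → ℝ} (hc : Continuous h) :
    ContinuousOn (fun x ↦ h (A.chartParam i x) / |A.speed i (A.chartParam i x)|)
      (A.chartRange i) := by
  refine (hc.comp_continuousOn (A.continuousOn_chartParam i)).div
    (((A.continuousOn_speed i).comp (A.continuousOn_chartParam i)
      fun x hx ↦ A.chartParam_mem hx).abs) fun x hx ↦ ?_
  exact abs_ne_zero.2 (A.speed_ne_zero (A.chartParam_mem hx))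

lemma integrableOn_density {i : A.W} {h : A.W → ℝ} (hc : Continuous h) {K : Set A.W}
    (hK : IsClosed K) (hKi : K ⊆ (chartAt (EuclideanHalfSpace 1) i).source)
    (hh : ∀ p ∉ K, h p = 0) :
    IntegrableOn (fun x ↦ h (A.chartParam i x) / |A.speed i (A.chartParam i x)|)
      (A.chartRange i) := by
  have hsub : A.chartCoord i '' K ⊆ A.chartRange i := by
    rintro _ ⟨p, hp, rfl⟩
    exact A.chartCoord_mem (hKi hp)
  have h1 := ((A.continuousOn_density hc).mono hsub).integrableOn_compact (μ := volume)
    (A.isCompact_chartCoord_image hK hKi)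
  refine h1.of_forall_sdiff_eq_zero (A.measurableSet_chartRange i) fun x hx ↦ ?_
  rw [hh, zero_div]
  intro hx'
  exact hx.2 ⟨_, hx', A.chartCoord_chartParam hx.1⟩

lemma chartIntegral_sum {ι : Type*} (s : Finset ι) {i : A.W} {h : ι → A.W → ℝ}
    (hc : ∀ k ∈ s, Continuous (h k)) {K : Set A.W}
    (hK : IsClosed K) (hKi : K ⊆ (chartAt (EuclideanHalfSpace 1) i).source)
    (hh : ∀ k ∈ s, ∀ p ∉ K, h k p = 0) :
    A.chartIntegral i (fun p ↦ ∑ k ∈ s, h k p) = ∑ k ∈ s, A.chartIntegral i (h k) := by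
  unfold chartIntegral
  rw [← integral_finsetSum _ fun k hk ↦ A.integrableOn_density (hc k hk) hK hKi (hh k hk)]
  simp only [Finset.sum_div]

/-! ### Stokes' theorem -/

lemma eventually_sign_speed_eq {i : A.W} {x : ℝ} (hx : x ∈ A.chartRange i) :
    ∀ᶠ y in 𝓝[Ici 0] x, y ∈ A.chartRange i ∧
      SignType.sign (A.speed i (A.chartParam i y)) =
        SignType.sign (A.speed i (A.chartParam i x)) := by
  have hne := A.speed_ne_zero (A.chartParam_mem hx)
  have hc := ((A.continuousOn_speed i).comp (A.continuousOn_chartParam i)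
    fun y hy ↦ A.chartParam_mem hy) x hx
  have hs := (continuousAt_sign_of_ne_zero hne).tendsto.comp hc
  have hmem := A.chartRange_mem_nhdsWithin hx
  have hs' := (hs.mono_left (nhdsWithin_le_of_mem hmem)).eventually
    ((isOpen_discrete {SignType.sign (A.speed i (A.chartParam i x))}).eventually_mem rfl)
  filter_upwards [hmem, hs'] with y h1 h2
  exact ⟨h1, h2⟩

/-- The fundamental theorem of calculus in one chart, for a function with compact support in the
chart. The right-hand side is the signed value at the endpoint `0` of the half-line, and is `0` if
the chart does not meet the boundary. -/
lemma chartIntegral_lieDeriv {i : A.W} {f : A.W → ℝ} (hf : ContMDiff (𝓡∂ 1) 𝓘(ℝ, ℝ) ∞ f)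
    (hi : tsupport f ⊆ (chartAt (EuclideanHalfSpace 1) i).source) :
    A.chartIntegral i (A.lieDeriv f) = -(A.chartRange i).indicator
      (fun x ↦ (SignType.sign (A.speed i (A.chartParam i x)) : ℝ) * f (A.chartParam i x)) 0 := by
  -- extended by zero, `sign(speed) • f` is differentiable on the half-line, as the sign of the
  -- speed is locally constant and `f` vanishes outside a compact subset of the chart
  set k : ℝ → ℝ := (A.chartRange i).indicator
      (fun x ↦ (SignType.sign (A.speed i (A.chartParam i x)) : ℝ) * f (A.chartParam i x)) with hk
  set k' : ℝ → ℝ := (A.chartRange i).indicator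
      (fun x ↦ A.lieDeriv f (A.chartParam i x) / |A.speed i (A.chartParam i x)|) with hk'
  have hK : IsCompact (A.chartCoord i '' tsupport f) :=
    A.isCompact_chartCoord_image (isClosed_tsupport f) hi
  have hk0 : ∀ x ∉ A.chartCoord i '' tsupport f, k x = 0 := by
    intro x hx
    by_cases hx' : x ∈ A.chartRange i
    · rw [hk, indicator_of_mem hx']
      have h0 : f (A.chartParam i x) = 0 := image_eq_zero_of_notMem_tsupport fun h ↦
        hx ⟨_, h, A.chartCoord_chartParam hx'⟩
      rw [h0, mul_zero]
    · exact indicator_of_notMem hx' _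
  have hderiv : ∀ x ∈ Ici (0 : ℝ), HasDerivWithinAt k (k' x) (Ici 0) x := by
    intro x _
    by_cases hx' : x ∈ A.chartRange i
    · have h1 := A.hasDerivWithinAt_comp_chartParam (A.chartParam_mem hx')
        (hf.mdifferentiable (by norm_num) _)
      rw [A.chartCoord_chartParam hx'] at h1
      have h2 := h1.const_mul (SignType.sign (A.speed i (A.chartParam i x)) : ℝ)
      refine (h2.congr_of_eventuallyEq ?_ ?_).congr_deriv ?_
      · filter_upwards [A.eventually_sign_speed_eq hx'] with y hy
        rw [hk, indicator_of_mem hy.1, hy.2]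
        rfl
      · rw [hk, indicator_of_mem hx']
        rfl
      · rw [hk', indicator_of_mem hx']
        have hne := A.speed_ne_zero (A.chartParam_mem hx')
        rcases lt_or_gt_of_ne hne with h | h
        · rw [sign_neg h, abs_of_neg h]
          simp [div_neg]
        · rw [sign_pos h, abs_of_pos h]
          simp
    · have hn : x ∉ A.chartCoord i '' tsupport f := by
        rintro ⟨p, hp, rfl⟩
        exact hx' (A.chartCoord_mem (hi hp))
      rw [hk', indicator_of_notMem hx']
      refine (hasDerivWithinAt_const x (Ici 0) (0 : ℝ)).congr_of_eventuallyEq ?_ (hk0 x hn)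
      exact (hK.isClosed.isOpen_compl.eventually_mem hn).filter_mono nhdsWithin_le_nhds |>.mono
        fun y hy ↦ hk0 y hy
  have hint : Integrable k' := by
    rw [hk', integrable_indicator_iff (A.measurableSet_chartRange i)]
    exact A.integrableOn_density (A.continuous_lieDeriv hf) (isClosed_tsupport f) hi
      fun p hp ↦ A.lieDeriv_eq_zero_of_notMem_tsupport hp
  have hlim : Tendsto k atTop (𝓝 0) := by
    obtain ⟨c, hc⟩ := hK.bddAbove
    refine tendsto_const_nhds.congr' ?_
    filter_upwards [eventually_gt_atTop c] with x hx
    exact (hk0 x fun h ↦ absurd (hc h) (not_le.2 hx)).symm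
  have hmain := integral_Ioi_of_hasDerivAt_of_tendsto (hderiv 0 self_mem_Ici).continuousWithinAt
    (fun x hx ↦ (hderiv x (mem_Ici_of_Ioi hx)).hasDerivAt (Ici_mem_nhds hx)) hint.integrableOn hlim
  rw [zero_sub] at hmain
  rw [← hmain, ← integral_Ici_eq_integral_Ioi, hk', setIntegral_indicator
    (A.measurableSet_chartRange i), inter_eq_self_of_subset_right (A.chartRange_subset i)]
  rfl

lemma chartCoord_eq_zero_iff {i p : A.W} (hp : p ∈ (chartAt (EuclideanHalfSpace 1) i).source) :
    A.chartCoord i p = 0 ↔ p ∈ (𝓡∂ 1).boundary A.W := by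
  have h := ModelWithCorners.isInteriorPoint_iff_of_mem_atlas (I := 𝓡∂ 1) (n := ∞)
    (by norm_num) (chart_mem_atlas (EuclideanHalfSpace 1) i) hp
  have hr : interior (range (𝓡∂ 1)) = {y : EuclideanSpace ℝ (Fin 1) | 0 < y 0} := by
    rw [range_modelWithCornersEuclideanHalfSpace, interior_halfSpace]
  have hmem := A.chartRange_subset i (A.chartCoord_mem hp)
  change _ ↔ (𝓡∂ 1).IsBoundaryPoint p
  rw [ModelWithCorners.isBoundaryPoint_iff_not_isInteriorPoint, h]
  constructor
  · intro h0 h1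
    have h2 := OpenPartialHomeomorph.interior_extend_target_subset_interior_range _ h1
    rw [hr] at h2
    exact h2.ne' h0
  · intro h1
    by_contra h0
    refine h1 ((chartAt (EuclideanHalfSpace 1) i).mem_interior_extend_target
      ((chartAt (EuclideanHalfSpace 1) i).map_source hp) ?_)
    have : (0:ℝ) < A.chartCoord i p := lt_of_le_of_ne hmem (Ne.symm h0)
    change extChartAt (𝓡∂ 1) i p ∈ interior (range (𝓡∂ 1))
    rw [hr]
    exact this

/-- At a boundary point every coordinate vanishes and is nonnegative nearby, so all of them
move in the same direction along the orienting vector field. -/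
lemma sign_speed_eq_of_mem_boundary {i p : A.W}
    (hp : p ∈ (chartAt (EuclideanHalfSpace 1) i).source) (hb : p ∈ (𝓡∂ 1).boundary A.W) :
    SignType.sign (A.speed i p) = SignType.sign (A.coord p) := by
  have hpp := mem_chart_source (EuclideanHalfSpace 1) p
  have h := A.hasDerivWithinAt_comp_chartParam hpp (A.mdifferentiableAt_chartCoord hp)
  have hm := A.chartCoord_mem hpp
  have he := A.chartParam_chartCoord hpp
  rw [(A.chartCoord_eq_zero_iff hpp).2 hb] at h hm he
  change HasDerivWithinAt _ (A.speed i p / A.speed p p) _ _ at h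
  have h0 : (0 : ℝ) ≤ A.speed i p / A.speed p p := by
    -- difference quotients at a zero of a nonnegative function on `[0, ∞)` are nonnegative
    have hnn : ∀ q, 0 ≤ A.chartCoord i q := fun q ↦ by
      have hr : extChartAt (𝓡∂ 1) i q ∈ range (𝓡∂ 1) := mem_range_self _
      rw [range_modelWithCornersEuclideanHalfSpace] at hr
      exact hr
    have hs := hasDerivWithinAt_iff_tendsto_slope.1 h
    rw [Ici_sdiff_left] at hs
    refine ge_of_tendsto hs ?_
    filter_upwards [self_mem_nhdsWithin] with y hy
    rw [slope_def_field, Function.comp_apply, Function.comp_apply, he,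
      (A.chartCoord_eq_zero_iff hp).2 hb, sub_zero, sub_zero]
    exact div_nonneg (hnn _) (le_of_lt hy)
  have h1 := A.speed_ne_zero hp
  have h2 := A.speed_ne_zero hpp
  rw [speed_self] at h0 h2
  rcases lt_or_gt_of_ne h1 with h1 | h1 <;> rcases lt_or_gt_of_ne h2 with h2 | h2
  · rw [sign_neg h1, sign_neg h2]
  · exact absurd (div_neg_of_neg_of_pos h1 h2) (not_lt.2 h0)
  · exact absurd (div_neg_of_pos_of_neg h1 h2) (not_lt.2 h0)
  · rw [sign_pos h1, sign_pos h2]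

lemma boundarySign_eq (p : A.W) :
    ((A.boundarySign p : ℤ) : ℝ) = -(SignType.sign (A.coord p) : ℝ) := by
  rcases lt_or_gt_of_ne (A.coord_ne_zero p) with h | h
  · rw [boundarySign, if_pos h, sign_neg h]
    simp
  · rw [boundarySign, if_neg (not_lt.2 h.le), sign_pos h]
    simp

/-- Stokes' theorem for a function supported in one chart. -/
lemma sum_boundarySign_mul_of_tsupport_subset {i : A.W} {f : A.W → ℝ}
    (hf : ContMDiff (𝓡∂ 1) 𝓘(ℝ, ℝ) ∞ f)
    (hi : tsupport f ⊆ (chartAt (EuclideanHalfSpace 1) i).source)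
    {D : Finset A.W} (hD : (D : Set A.W) = (𝓡∂ 1).boundary A.W) :
    ∑ p ∈ D, ((A.boundarySign p : ℤ) : ℝ) * f p = A.chartIntegral i (A.lieDeriv f) := by
  have hf0 : ∀ p ∉ (chartAt (EuclideanHalfSpace 1) i).source, f p = 0 := fun p hp ↦
    image_eq_zero_of_notMem_tsupport fun h ↦ hp (hi h)
  have hmemD : ∀ p, p ∈ D ↔ p ∈ (𝓡∂ 1).boundary A.W := fun p ↦ by rw [← hD]; rfl
  rw [A.chartIntegral_lieDeriv hf hi]
  by_cases h0 : (0 : ℝ) ∈ A.chartRange i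
  · have hq := A.chartParam_mem h0
    have hqb : A.chartParam i 0 ∈ (𝓡∂ 1).boundary A.W :=
      (A.chartCoord_eq_zero_iff hq).1 (A.chartCoord_chartParam h0)
    rw [Finset.sum_eq_single (A.chartParam i 0), indicator_of_mem h0, boundarySign_eq,
      A.sign_speed_eq_of_mem_boundary hq hqb, neg_mul]
    · intro p hpD hp
      rw [hf0, mul_zero]
      intro hps
      apply hp
      rw [← (A.chartCoord_eq_zero_iff hps).2 ((hmemD p).1 hpD), A.chartParam_chartCoord hps]
    · exact fun h ↦ absurd ((hmemD _).2 hqb) h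
  · rw [indicator_of_notMem h0, neg_zero]
    refine Finset.sum_eq_zero fun p hp ↦ ?_
    rw [hf0, mul_zero]
    intro hps
    apply h0
    rw [← (A.chartCoord_eq_zero_iff hps).2 ((hmemD p).1 hp)]
    exact A.chartCoord_mem hps

/-- Stokes' theorem for locally constant functions: the oriented boundary of a compact oriented
`1`-manifold has as many positive as negative points in each clopen part. -/
theorem sum_boundarySign_mul_of_isLocallyConstant {χ : A.W → ℝ} (hχ : IsLocallyConstant χ)
    {D : Finset A.W} (hD : (D : Set A.W) = (𝓡∂ 1).boundary A.W) :
    ∑ p ∈ D, ((A.boundarySign p : ℤ) : ℝ) * χ p = 0 := by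
  classical
  obtain ⟨ρ, hρ⟩ := SmoothPartitionOfUnity.exists_isSubordinate_chartAt_source (𝓡∂ 1) A.W
  have hfin : {i | (Function.support (ρ i)).Nonempty}.Finite :=
    ρ.locallyFinite.finite_nonempty_of_compact
  set s := hfin.toFinset with hs
  have hsum : ∀ p, ∑ i ∈ s, ρ i p = 1 := by
    intro p
    have h1 := ρ.sum_eq_one (mem_univ p)
    rwa [finsum_eq_sum_of_support_subset (s := s)] at h1
    intro i hi
    rw [Finset.mem_coe, hs, Finite.mem_toFinset]
    exact ⟨p, hi⟩
  have hχs : ContMDiff (𝓡∂ 1) 𝓘(ℝ, ℝ) ∞ χ := by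
    intro p
    exact contMDiffAt_const.congr_of_eventuallyEq (hχ.eventually_eq p)
  have hχ0 : ∀ p, A.lieDeriv χ p = 0 := by
    intro p
    rw [A.lieDeriv_congr (hχ.eventually_eq p)]
    exact A.lieDeriv_const _ p
  set f : A.W → A.W → ℝ := fun i p ↦ ρ i p * χ p with hfdef
  have hf : ∀ i, ContMDiff (𝓡∂ 1) 𝓘(ℝ, ℝ) ∞ (f i) := fun i ↦ (ρ i).contMDiff.mul hχs
  have hfs : ∀ i, tsupport (f i) ⊆ tsupport (ρ i) := fun i ↦ by
    refine closure_mono fun p hp ↦ ?_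
    exact left_ne_zero_of_mul hp
  have hsumf : ∀ p, ∑ i ∈ s, f i p = χ p := by
    intro p
    rw [← Finset.sum_mul, hsum, one_mul]
  have hD0 : ∀ p, ∑ i ∈ s, A.lieDeriv (f i) p = 0 := by
    intro p
    rw [← A.lieDeriv_sum s f (fun i _ ↦ hf i), ← hχ0 p]
    congr 1
    exact funext hsumf
  have hcont : ∀ i j, Continuous (fun p ↦ ρ j p * A.lieDeriv (f i) p) := fun i j ↦
    (ρ j).contMDiff.continuous.mul (A.continuous_lieDeriv (hf i))
  have hz1 : ∀ i j, ∀ p ∉ tsupport (ρ i), ρ j p * A.lieDeriv (f i) p = 0 := by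
    intro i j p hp
    rw [A.lieDeriv_eq_zero_of_notMem_tsupport fun h ↦ hp (hfs i h), mul_zero]
  have hz2 : ∀ i j, ∀ p ∉ tsupport (ρ j), ρ j p * A.lieDeriv (f i) p = 0 := by
    intro i j p hp
    rw [image_eq_zero_of_notMem_tsupport hp, zero_mul]
  calc ∑ p ∈ D, ((A.boundarySign p : ℤ) : ℝ) * χ p
      = ∑ i ∈ s, ∑ p ∈ D, ((A.boundarySign p : ℤ) : ℝ) * f i p := by
        rw [Finset.sum_comm]
        simp only [← Finset.mul_sum, hsumf]
    _ = ∑ i ∈ s, A.chartIntegral i (A.lieDeriv (f i)) :=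
        Finset.sum_congr rfl fun i _ ↦
          A.sum_boundarySign_mul_of_tsupport_subset (hf i) ((hfs i).trans (hρ i)) hD
    _ = ∑ i ∈ s, ∑ j ∈ s, A.chartIntegral i (fun p ↦ ρ j p * A.lieDeriv (f i) p) := by
        refine Finset.sum_congr rfl fun i _ ↦ ?_
        rw [← A.chartIntegral_sum s (fun j _ ↦ hcont i j) (isClosed_tsupport (ρ i)) (hρ i)
          fun j _ ↦ hz1 i j]
        congr 1
        ext p
        rw [← Finset.sum_mul, hsum, one_mul]
    _ = ∑ i ∈ s, ∑ j ∈ s, A.chartIntegral j (fun p ↦ ρ j p * A.lieDeriv (f i) p) := by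
        refine Finset.sum_congr rfl fun i _ ↦ Finset.sum_congr rfl fun j _ ↦ ?_
        exact A.chartIntegral_eq_of_support (fun p hp ↦ hz1 i j p fun h ↦ hp (hρ i h))
          (fun p hp ↦ hz2 i j p fun h ↦ hp (hρ j h))
    _ = ∑ j ∈ s, A.chartIntegral j (fun p ↦ ∑ i ∈ s, ρ j p * A.lieDeriv (f i) p) := by
        rw [Finset.sum_comm]
        refine Finset.sum_congr rfl fun j _ ↦ ?_
        rw [A.chartIntegral_sum s (fun i _ ↦ hcont i j) (isClosed_tsupport (ρ j)) (hρ j)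
          fun i _ ↦ hz2 i j]
    _ = 0 := by
        refine Finset.sum_eq_zero fun j _ ↦ ?_
        simp only [← Finset.mul_sum, hD0]
        simp [chartIntegral]

end SingularArcs

/-! ### Counting points in path components -/

section BordismComponents

variable {X : Type*} [TopologicalSpace X]

/-- The number of points, counted with sign, of a signed `0`-manifold in each path component. -/
def componentCount (X : Type*) [TopologicalSpace X] :
    SignedPoints X →+ (ZerothHomotopy X →₀ ℤ) where
  toFun s := (s.map fun q ↦ Finsupp.single (ZerothHomotopy.mk q.1) (q.2 : ℤ)).sum
  map_zero' := by simp
  map_add' s t := by simp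

lemma componentCount_singleton (x : X) (ε : ℤˣ) :
    componentCount X {(x, ε)} = Finsupp.single (ZerothHomotopy.mk x) (ε : ℤ) :=
  Multiset.sum_singleton _

lemma componentCount_reverseSigns (s : SignedPoints X) :
    componentCount X (reverseSigns s) = -componentCount X s := by
  induction s using Multiset.induction_on with
  | empty => simp
  | cons q s ih =>
    rw [← Multiset.singleton_add, map_add, map_add, map_add, ih, neg_add]
    congr 1
    obtain ⟨x, ε⟩ := q
    change componentCount X (Multiset.map _ {(x, ε)}) = _
    rw [Multiset.map_singleton, componentCount_singleton, componentCount_singleton]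
    simp

lemma SingularArcs.isLocallyConstant_component (A : SingularArcs X) :
    IsLocallyConstant (fun p ↦ ZerothHomotopy.mk (A.g p)) := by
  have : LocallyPathConnectedSpace A.W :=
    ChartedSpace.locallyPathConnectedSpace (EuclideanHalfSpace 1) A.W
  refine (IsLocallyConstant.iff_exists_open _).2 fun p ↦
    ⟨pathComponent p, IsOpen.pathComponent p, mem_pathComponent_self p, fun q hq ↦ ?_⟩
  exact Quotient.sound (hq.map A.g.continuous).symm

/-- Bordant `0`-manifolds have the same signed number of points in each path component, by
Stokes' theorem applied to the indicator function of the preimage of the component. -/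
lemma Bordant.componentCount_eq {s t : SignedPoints X} (h : Bordant s t) :
    componentCount X s = componentCount X t := by
  classical
  obtain ⟨A, D, hD, hs⟩ := h
  rw [← sub_eq_zero, sub_eq_add_neg, ← componentCount_reverseSigns, ← map_add, ← hs]
  ext c
  have hχ : IsLocallyConstant
      (fun p ↦ if ZerothHomotopy.mk (A.g p) = c then (1 : ℝ) else 0) :=
    A.isLocallyConstant_component.comp fun d ↦ if d = c then (1 : ℝ) else 0
  have h := A.sum_boundarySign_mul_of_isLocallyConstant hχ hD
  have e : componentCount X (D.val.map fun p ↦ (A.g p, A.boundarySign p)) =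
      ∑ p ∈ D, Finsupp.single (ZerothHomotopy.mk (A.g p)) (A.boundarySign p : ℤ) :=
    congrArg Multiset.sum (Multiset.map_map _ _ _)
  rw [e, Finsupp.finsetSum_apply, Finsupp.zero_apply]
  rw [← Int.cast_inj (α := ℝ), Int.cast_sum, Int.cast_zero, ← h]
  refine Finset.sum_congr rfl fun p _ ↦ ?_
  rw [Finsupp.single_apply]
  split_ifs <;> simp

/-- The homomorphism from the bordism group to the free abelian group on the path components. -/
def BordismZero.toFinsupp (X : Type*) [TopologicalSpace X] :
    BordismZero X →+ (ZerothHomotopy X →₀ ℤ) :=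
  AddCon.lift (bordismCon X) (componentCount X)
    (AddCon.addConGen_le.2 fun _ _ h ↦ h.componentCount_eq)

lemma BordismZero.toFinsupp_surjective : Function.Surjective (BordismZero.toFinsupp X) := by
  intro a
  induction a using Finsupp.induction_linear with
  | zero => exact ⟨0, map_zero _⟩
  | add f g hf hg =>
    obtain ⟨a, rfl⟩ := hf
    obtain ⟨b, rfl⟩ := hg
    exact ⟨a + b, map_add _ _ _⟩
  | single c n =>
    obtain ⟨x, rfl⟩ := Quotient.exists_rep c
    have h1 : BordismZero.toFinsupp X (((bordismCon X).mk' {(x, 1)} : (bordismCon X).Quotient)) =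
        Finsupp.single (ZerothHomotopy.mk x) 1 :=
      componentCount_singleton x 1
    refine ⟨n • (show BordismZero X from (bordismCon X).mk' {(x, 1)}), ?_⟩
    rw [map_zsmul]
    refine (congrArg (n • ·) h1).trans ?_
    simp
    rfl

/-- A space with infinitely many path components has a bordism group `Ω₀` which is not finitely
generated. -/
theorem BordismZero.not_fg [Infinite (ZerothHomotopy X)] : ¬ AddGroup.FG (BordismZero X) := by
  intro h
  have h1 : AddGroup.FG (ZerothHomotopy X →₀ ℤ) :=
    AddGroup.fg_of_surjective (BordismZero.toFinsupp_surjective (X := X))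
  have h2 : Module.Finite ℤ (ZerothHomotopy X →₀ ℤ) := Module.Finite.iff_addGroup_fg.2 h1
  have h3 := Module.Finite.finite_basis (Finsupp.basisSingleOne (R := ℤ) (ι := ZerothHomotopy X))
  exact not_finite (ZerothHomotopy X)

end BordismComponents

/-! ### The `C^∞` topology: evaluation and smooth families -/

section SmoothFamilies

/-- The partial derivatives of all orders in the second variable are jointly smooth in both. -/
lemma ContDiffAt.iteratedFDeriv_slice {E F : Type*} [NormedAddCommGroup E] [NormedSpace ℝ E]
    [NormedAddCommGroup F] [NormedSpace ℝ F] {G : ℝ × E → F} {q₀ : ℝ × E}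
    (hG : ContDiffAt ℝ ∞ G q₀) (j : ℕ) :
    ContDiffAt ℝ ∞ (fun q : ℝ × E ↦ iteratedFDeriv ℝ j (fun u ↦ G (q.1, u)) q.2) q₀ := by
  induction j with
  | zero =>
    simp only [iteratedFDeriv_zero_eq_comp]
    exact (continuousMultilinearCurryFin0 ℝ E F).symm.contDiff.contDiffAt.comp q₀ hG
  | succ j ih =>
    simp only [iteratedFDeriv_succ_eq_comp_left, Function.comp_apply]
    refine (LinearIsometryEquiv.contDiff (𝕜 := ℝ) (E := E →L[ℝ] E [×j]→L[ℝ] F)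
      (F := E [×(j + 1)]→L[ℝ] F) (continuousMultilinearCurryLeftEquiv ℝ
        (fun _ : Fin (j + 1) ↦ E) F).symm).contDiffAt.comp q₀ ?_
    refine ContDiffAt.fderiv (n := ∞)
      (f := fun (q : ℝ × E) u ↦ iteratedFDeriv ℝ j (fun u ↦ G (q.1, u)) u) (g := Prod.snd)
      ?_ contDiffAt_snd (by norm_num)
    have h : ContDiffAt ℝ ∞ (fun z : (ℝ × E) × E ↦ (z.1.1, z.2)) (q₀, q₀.2) := by fun_prop
    exact ContDiffAt.comp (q₀, q₀.2) (g := fun q : ℝ × E ↦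
      iteratedFDeriv ℝ j (fun u ↦ G (q.1, u)) q.2) ih h

variable {n m : ℕ}
  {N : Type*} [TopologicalSpace N] [ChartedSpace (EuclideanSpace ℝ (Fin n)) N]
  {M : Type*} [TopologicalSpace M] [ChartedSpace (EuclideanSpace ℝ (Fin m)) M]

/-- The space of smooth maps is finer than the compact-open topology: evaluation is continuous. -/
lemma continuous_smoothMap_eval [IsManifold (𝓡 n) ∞ N] [IsManifold (𝓡 m) ∞ M] :
    Continuous (fun q : C^∞⟮𝓡 n, N; 𝓡 m, M⟯ × N ↦ q.1 q.2) := by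
  have : LocallyCompactSpace N := ChartedSpace.locallyCompactSpace (EuclideanSpace ℝ (Fin n)) N
  rw [continuous_iff_continuousAt]
  rintro ⟨f, x⟩
  intro V hV
  rw [Filter.mem_map]
  set φ := chartAt (EuclideanSpace ℝ (Fin n)) x with hφ
  set ψ := chartAt (EuclideanSpace ℝ (Fin m)) (f x) with hψ
  have hs : f x ∈ ψ.source := mem_chart_source _ _
  have hV' : ψ.symm ⁻¹' V ∈ 𝓝 (ψ (f x)) := by
    have h := ψ.symm.continuousAt (ψ.map_source hs)
    rw [ContinuousAt, ψ.left_inv hs] at h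
    exact h hV
  obtain ⟨ε, hε, hball⟩ := Metric.mem_nhds_iff.1 hV'
  have hW : φ.source ∩ f ⁻¹' (ψ.source ∩ ψ ⁻¹' Metric.ball (ψ (f x)) (ε / 2)) ∈ 𝓝 x := by
    refine Filter.inter_mem (φ.open_source.mem_nhds (mem_chart_source _ x)) ?_
    refine f.contMDiff.continuous.continuousAt (Filter.inter_mem (ψ.open_source.mem_nhds hs) ?_)
    exact ψ.continuousAt hs (Metric.ball_mem_nhds _ (half_pos hε))
  obtain ⟨K, hK, hKW, hKc⟩ := local_compact_nhds hW
  have hO : IsOpen (smoothNhd f φ ψ K 0 (ε / 2)) :=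
    TopologicalSpace.isOpen_generateFrom_of_mem ⟨f, φ, ψ, K, 0, ε / 2,
      IsManifold.chart_mem_maximalAtlas _, IsManifold.chart_mem_maximalAtlas _, hKc,
      fun z hz ↦ (hKW hz).1, fun z hz ↦ (hKW hz).2.1, half_pos hε, rfl⟩
  have hf : f ∈ smoothNhd f φ ψ K 0 (ε / 2) :=
    ⟨fun z hz ↦ (hKW hz).2.1, fun j _ z _ ↦ by simpa using half_pos hε⟩
  filter_upwards [prod_mem_nhds (hO.mem_nhds hf) hK] with ⟨g, z⟩ ⟨hg, hz⟩
  have h1 := hg.2 0 le_rfl z hz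
  have hz1 := (hKW hz).1
  have h2 : ‖ψ (g z) - ψ (f z)‖ < ε / 2 := by
    rw [iteratedFDeriv_zero_eq_comp, iteratedFDeriv_zero_eq_comp] at h1
    let ι := (continuousMultilinearCurryFin0 ℝ
      (EuclideanSpace ℝ (Fin n)) (EuclideanSpace ℝ (Fin m))).symm
    change ‖ι (ψ (g (φ.symm (φ z)))) - ι (ψ (f (φ.symm (φ z))))‖ < ε / 2 at h1
    rwa [φ.left_inv hz1, ← map_sub, LinearIsometryEquiv.norm_map] at h1
  have h3 : dist (ψ (f z)) (ψ (f x)) < ε / 2 := (hKW hz).2.2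
  rw [← dist_eq_norm] at h2
  have h4 : ψ (g z) ∈ Metric.ball (ψ (f x)) ε :=
    (dist_triangle _ _ _).trans_lt (by linarith)
  have h5 := hball h4
  rwa [mem_preimage, ψ.left_inv (hg.1 hz)] at h5

/-- A jointly smooth one-parameter family of maps is continuous in the parameter for the `C^∞`
topology. -/
lemma continuous_of_contMDiff_family {F : ℝ → C^∞⟮𝓡 n, N; 𝓡 m, M⟯}
    (hF : ContMDiff (𝓘(ℝ, ℝ).prod (𝓡 n)) (𝓡 m) ∞ (fun q : ℝ × N ↦ F q.1 q.2)) :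
    Continuous F := by
  refine continuous_generateFrom_iff.2 ?_
  rintro _ ⟨f, φ, ψ, K, r, ε, hφ, hψ, hK, hKφ, hfK, hε, rfl⟩
  rw [isOpen_iff_mem_nhds]
  rintro t ⟨htK, ht⟩
  have hFc : Continuous (fun q : ℝ × N ↦ F q.1 q.2) := hF.continuous
  have h1 : ∀ᶠ s in 𝓝 t, ∀ x ∈ K, F s x ∈ ψ.source :=
    hK.eventually_forall_of_forall_eventually fun x hx ↦
      (hFc.tendsto (t, x)) (ψ.open_source.mem_nhds (htK hx))
  have hsmooth : ∀ (G : ℝ → C^∞⟮𝓡 n, N; 𝓡 m, M⟯)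
      (_ : ContMDiff (𝓘(ℝ, ℝ).prod (𝓡 n)) (𝓡 m) ∞ (fun q : ℝ × N ↦ G q.1 q.2))
      (x : N) (_ : x ∈ K) (_ : G t x ∈ ψ.source),
      ContDiffAt ℝ ∞ (fun q : ℝ × EuclideanSpace ℝ (Fin n) ↦
        (ψ ∘ G q.1 ∘ φ.symm) q.2) (t, φ x) := by
    intro G hG x hx hGx
    have hxs := hKφ hx
    have e1 : ContMDiffAt (𝓡 m) (𝓡 m) ∞ ψ (G t (φ.symm (φ x))) := by
      rw [φ.left_inv hxs]
      exact contMDiffAt_of_mem_maximalAtlas hψ hGx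
    have e2 : ContMDiffAt (𝓡 n) (𝓡 n) ∞ φ.symm (φ x) :=
      contMDiffAt_symm_of_mem_maximalAtlas hφ (φ.map_source hxs)
    have e3 : ContMDiffAt (𝓘(ℝ, ℝ).prod (𝓡 n)) (𝓘(ℝ, ℝ).prod (𝓡 n)) ∞
        (fun q : ℝ × EuclideanSpace ℝ (Fin n) ↦ (q.1, φ.symm q.2)) (t, φ x) :=
      contMDiffAt_fst.prodMk (e2.comp (t, φ x) contMDiffAt_snd)
    have e4 := (hG (t, φ.symm (φ x))).comp (t, φ x) e3
    have e5 := e1.comp (t, φ x) e4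
    rw [← contMDiffAt_iff_contDiffAt]
    rw [modelWithCornersSelf_prod, ← chartedSpaceSelf_prod]
    exact e5
  have h2 : ∀ j ∈ Iic r, ∀ᶠ s in 𝓝 t, ∀ x ∈ K,
      ‖iteratedFDeriv ℝ j (ψ ∘ F s ∘ φ.symm) (φ x) -
        iteratedFDeriv ℝ j (ψ ∘ f ∘ φ.symm) (φ x)‖ < ε := by
    intro j hj
    refine hK.eventually_forall_of_forall_eventually fun x hx ↦ ?_
    have hc1 := ((hsmooth F hF x hx (htK hx)).iteratedFDeriv_slice j).continuousAt
    have hc2 := ((hsmooth (fun _ ↦ f) (f.contMDiff.comp contMDiff_snd) x hx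
      (hfK hx)).iteratedFDeriv_slice j).continuousAt
    have hφc : ContinuousAt (fun z : ℝ × N ↦ (z.1, φ z.2)) (t, x) :=
      continuousAt_fst.prodMk ((φ.continuousAt (hKφ hx)).comp continuousAt_snd)
    have hc := ((hc1.sub hc2).norm).comp_of_eq hφc rfl
    exact hc.eventually_lt_const (ht j hj x hx)
  filter_upwards [h1, (finite_Iic r).eventually_all.2 h2] with s hs1 hs2
  exact ⟨hs1, fun j hj ↦ hs2 j hj⟩

end SmoothFamilies

/-! ### Pushing smooth maps along paths -/

section Push

variable {n m : ℕ}
  {N : Type*} [TopologicalSpace N] [ChartedSpace (EuclideanSpace ℝ (Fin n)) N]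
  {M : Type*} [TopologicalSpace M] [ChartedSpace (EuclideanSpace ℝ (Fin m)) M]

/-- Two paths with the same endpoints inside a ball of a chart are homotopic in the manifold. -/
lemma homotopic_of_mem_chart_ball {E : Type*} [NormedAddCommGroup E] [NormedSpace ℝ E]
    {Y : Type*} [TopologicalSpace Y] (ψ : OpenPartialHomeomorph Y E) {c : E} {r : ℝ}
    (hr : Metric.ball c r ⊆ ψ.target) {a b : Y} (p q : Path a b)
    (hp : ∀ s, p s ∈ ψ.source ∩ ψ ⁻¹' Metric.ball c r)
    (hq : ∀ s, q s ∈ ψ.source ∩ ψ ⁻¹' Metric.ball c r) : p.Homotopic q := by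
  have ha : a ∈ ψ.source ∩ ψ ⁻¹' Metric.ball c r := by simpa using hp 0
  have hb : b ∈ ψ.source ∩ ψ ⁻¹' Metric.ball c r := by simpa using hp 1
  let lift : ∀ p : Path a b, (∀ s, p s ∈ ψ.source ∩ ψ ⁻¹' Metric.ball c r) →
      Path (⟨ψ a, ha.2⟩ : Metric.ball c r) ⟨ψ b, hb.2⟩ := fun p hp ↦
    { toFun := fun s ↦ ⟨ψ (p s), (hp s).2⟩
      continuous_toFun := by
        refine Continuous.subtype_mk ?_ _
        exact ψ.continuousOn.comp_continuous p.continuous fun s ↦ (hp s).1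
      source' := by simp
      target' := by simp }
  have : ContractibleSpace (Metric.ball c r) :=
    (convex_ball c r).contractibleSpace ⟨_, ha.2⟩
  let σ : C(Metric.ball c r, Y) :=
    ⟨fun z ↦ ψ.symm z, ψ.symm.continuousOn.comp_continuous continuous_subtype_val
      fun z ↦ hr z.2⟩
  have h := ((SimplyConnectedSpace.paths_homotopic (lift p hp) (lift q hq)).map σ).pathCast
    (ψ.left_inv ha.1).symm (ψ.left_inv hb.1).symm
  have e : ∀ p hp, ((lift p hp).map σ.continuous).cast (ψ.left_inv ha.1).symm
      (ψ.left_inv hb.1).symm = p := by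
    intro p hp
    ext s
    exact ψ.left_inv (hp s).1
  rwa [e p hp, e q hq] at h

/-- Every point of a manifold has a neighbourhood `U` in which paths with equal endpoints are
homotopic, and in which every point can be pushed along a path in `U` to every other one by a
smooth homotopy of the identity map of the manifold. -/
lemma exists_nhds_push [IsManifold (𝓡 m) ∞ M] [T2Space M] (c : M) :
    ∃ U ∈ 𝓝 c,
      (∀ (a b : M) (p q : Path a b), (∀ s, p s ∈ U) → (∀ s, q s ∈ U) → p.Homotopic q) ∧
      ∀ a ∈ U, ∀ b ∈ U, ∃ E : ℝ → M → M,
        ContMDiff (𝓘(ℝ, ℝ).prod (𝓡 m)) (𝓡 m) ∞ (fun q : ℝ × M ↦ E q.1 q.2) ∧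
        (∀ x, E 0 x = x) ∧ E 1 a = b ∧ ∀ t, E t a ∈ U := by
  classical
  set ψ := chartAt (EuclideanSpace ℝ (Fin m)) c with hψdef
  have hψ : ψ ∈ IsManifold.maximalAtlas (𝓡 m) ∞ M := IsManifold.chart_mem_maximalAtlas _
  have hc : c ∈ ψ.source := mem_chart_source _ c
  obtain ⟨R, hR, hball⟩ := Metric.mem_nhds_iff.1 (ψ.open_target.mem_nhds (ψ.map_source hc))
  -- bump functions live in the ball of radius `2 * r`, pushed points in that of radius `4 * r`
  set r := R / 4 with hrdef
  have hr : 0 < r := by positivity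
  have hsub : Metric.ball (ψ c) r ⊆ ψ.target :=
    (Metric.ball_subset_ball (by linarith)).trans hball
  refine ⟨ψ.source ∩ ψ ⁻¹' Metric.ball (ψ c) r, ?_, fun a b p q hp hq ↦
    homotopic_of_mem_chart_ball ψ hsub p q hp hq, ?_⟩
  · exact Filter.inter_mem (ψ.open_source.mem_nhds hc)
      (ψ.continuousAt hc (Metric.ball_mem_nhds _ hr))
  rintro a ⟨ha, ha'⟩ b ⟨hb, hb'⟩
  let β : ContDiffBump (ψ c) := ⟨r, 2 * r, hr, by linarith⟩
  set v := ψ b - ψ a with hv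
  have hvr : ‖v‖ < 2 * r := by
    rw [hv, ← dist_eq_norm]
    refine (dist_triangle_right _ _ (ψ c)).trans_lt ?_
    have h1 : dist (ψ b) (ψ c) < r := hb'
    have h2 : dist (ψ a) (ψ c) < r := ha'
    linarith
  let P : ℝ × EuclideanSpace ℝ (Fin m) → EuclideanSpace ℝ (Fin m) :=
    fun q ↦ q.2 + (Real.smoothTransition q.1 * β q.2) • v
  have hPs : ContDiff ℝ ∞ P := by
    have h1 : ContDiff ℝ ∞ fun q : ℝ × EuclideanSpace ℝ (Fin m) ↦
        Real.smoothTransition q.1 * β q.2 :=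
      (Real.smoothTransition.contDiff.comp contDiff_fst).mul (β.contDiff.comp contDiff_snd)
    exact contDiff_snd.add (h1.smul contDiff_const)
  have hP0 : ∀ t u, u ∉ Metric.ball (ψ c) (2 * r) → P (t, u) = u := by
    intro t u hu
    have : β u = 0 := β.zero_of_le_dist (not_lt.1 hu)
    simp [P, this]
  have hPt : ∀ t, ∀ u ∈ ψ.target, P (t, u) ∈ ψ.target := by
    intro t u hu
    by_cases hu' : u ∈ Metric.ball (ψ c) (2 * r)
    · apply hball
      have h1 : dist u (ψ c) < 2 * r := hu'
      have h2 : ‖(Real.smoothTransition t * β u) • v‖ ≤ ‖v‖ := by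
        rw [norm_smul, Real.norm_of_nonneg (mul_nonneg (Real.smoothTransition.nonneg _) β.nonneg)]
        exact mul_le_of_le_one_left (norm_nonneg _)
          (mul_le_one₀ (Real.smoothTransition.le_one _) β.nonneg β.le_one)
      rw [Metric.mem_ball, dist_eq_norm]
      rw [dist_eq_norm] at h1
      calc ‖P (t, u) - ψ c‖ = ‖(u - ψ c) + (Real.smoothTransition t * β u) • v‖ := by
            congr 1
            simp only [P]
            abel
        _ ≤ ‖u - ψ c‖ + ‖(Real.smoothTransition t * β u) • v‖ := norm_add_le _ _
        _ < R := by linarith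
    · rwa [hP0 t u hu']
  let E : ℝ → M → M := fun t x ↦ if x ∈ ψ.source then ψ.symm (P (t, ψ x)) else x
  have hPa : ∀ t, P (t, ψ a) = ψ a + Real.smoothTransition t • v := by
    intro t
    have : β (ψ a) = 1 := β.one_of_mem_closedBall (Metric.ball_subset_closedBall ha')
    simp [P, this]
  refine ⟨E, ?_, ?_, ?_, ?_⟩
  · have hK : IsCompact (ψ.symm '' Metric.closedBall (ψ c) (2 * r)) := by
      refine (isCompact_closedBall _ _).image_of_continuousOn (ψ.symm.continuousOn.mono ?_)
      exact (Metric.closedBall_subset_ball (by linarith)).trans hball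
    have hKs : ψ.symm '' Metric.closedBall (ψ c) (2 * r) ⊆ ψ.source := by
      rintro _ ⟨u, hu, rfl⟩
      exact ψ.map_target (hball (Metric.closedBall_subset_ball (by linarith) hu))
    rintro ⟨t, x⟩
    by_cases hx : x ∈ ψ.source
    · have e1 : ContMDiffAt (𝓡 m) (𝓡 m) ∞ ψ x := contMDiffAt_of_mem_maximalAtlas hψ hx
      have e2 : ContMDiffAt (𝓘(ℝ, ℝ).prod (𝓡 m)) (𝓘(ℝ, ℝ).prod (𝓡 m)) ∞
          (fun q : ℝ × M ↦ (q.1, ψ q.2)) (t, x) :=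
        contMDiffAt_fst.prodMk (e1.comp (t, x) contMDiffAt_snd)
      have e3 : ContMDiff (𝓘(ℝ, ℝ).prod (𝓡 m)) (𝓡 m) ∞ P := by
        have := hPs.contMDiff
        rwa [modelWithCornersSelf_prod, ← chartedSpaceSelf_prod] at this
      have e4 : ContMDiffAt (𝓡 m) (𝓡 m) ∞ ψ.symm (P (t, ψ x)) :=
        contMDiffAt_symm_of_mem_maximalAtlas hψ (hPt t _ (ψ.map_source hx))
      have e5 := e4.comp (t, x) ((e3 (t, ψ x)).comp (t, x) e2)
      refine e5.congr_of_eventuallyEq ?_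
      filter_upwards [continuousAt_snd.eventually_mem (ψ.open_source.mem_nhds hx)] with q hq
      exact if_pos hq
    · have hxK : x ∉ ψ.symm '' Metric.closedBall (ψ c) (2 * r) := fun h ↦ hx (hKs h)
      refine contMDiffAt_snd.congr_of_eventuallyEq ?_
      filter_upwards [continuousAt_snd.eventually_mem (hK.isClosed.isOpen_compl.mem_nhds hxK)]
        with q hq
      by_cases hqs : q.2 ∈ ψ.source
      · refine (if_pos hqs).trans ?_
        rw [hP0, ψ.left_inv hqs]
        intro h
        exact hq ⟨_, Metric.ball_subset_closedBall h, ψ.left_inv hqs⟩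
      · exact if_neg hqs
  · intro x
    by_cases hx : x ∈ ψ.source
    · refine (if_pos hx).trans ?_
      simp [P, Real.smoothTransition.zero, ψ.left_inv hx]
    · exact if_neg hx
  · refine (if_pos ha).trans ?_
    rw [hPa, Real.smoothTransition.one, one_smul, hv, add_sub_cancel, ψ.left_inv hb]
  · intro t
    have hmem : P (t, ψ a) ∈ Metric.ball (ψ c) r := by
      rw [hPa, hv]
      exact (convex_ball (ψ c) r).add_smul_sub_mem ha' hb'
        ⟨Real.smoothTransition.nonneg _, Real.smoothTransition.le_one _⟩
    have hE : E t a = ψ.symm (P (t, ψ a)) := if_pos ha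
    rw [hE]
    refine ⟨ψ.map_target (hsub hmem), ?_⟩
    rw [mem_preimage, ψ.right_inv (hsub hmem)]
    exact hmem

/-- Homotopy extension for smooth maps: every path `α` starting at `f y` is, up to homotopy, the
track of `y` under a path in the space of smooth maps that starts at `f`. -/
theorem exists_path_smoothMap [IsManifold (𝓡 m) ∞ M] [T2Space M]
    (f : C^∞⟮𝓡 n, N; 𝓡 m, M⟯) (y : N) {x₁ : M} (α : Path (f y) x₁) :
    ∃ (g : C^∞⟮𝓡 n, N; 𝓡 m, M⟯) (γ : Path f g) (δ : Path (f y) x₁),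
      (∀ s, δ s = γ s y) ∧ δ.Homotopic α := by
  have : LocallyPathConnectedSpace unitInterval := (convex_Icc (0 : ℝ) 1).locallyPathConnectedSpace
  have : ContractibleSpace unitInterval := (convex_Icc (0 : ℝ) 1).contractibleSpace ⟨0, by simp⟩
  -- `Q t`: the initial piece of `α` that ends at `α t` can be realised; pushing inside small
  -- neighbourhoods shows that the truth of `Q` is locally constant
  let Q : unitInterval → Prop := fun t ↦
    ∃ (g : C^∞⟮𝓡 n, N; 𝓡 m, M⟯) (γ : Path f g) (δ : Path (f y) (α t)) (η : Path 0 t),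
      (∀ s, δ s = γ s y) ∧ δ.Homotopic ((η.map α.continuous).cast α.source.symm rfl)
  have hstep : ∀ τ : unitInterval, ∃ V ∈ 𝓝 τ, ∀ t ∈ V, ∀ t' ∈ V, Q t → Q t' := by
    intro τ
    obtain ⟨U, hU, hhom, hpush⟩ := exists_nhds_push (m := m) (α τ)
    obtain ⟨V, ⟨hV, hVc⟩, hVU⟩ := (LocallyPathConnectedSpace.path_connected_basis τ).mem_iff.1
      (α.continuous.continuousAt.preimage_mem_nhds hU)
    refine ⟨V, hV, fun t ht t' ht' ↦ ?_⟩
    rintro ⟨g, γ, δ, η, hγ, hδ⟩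
    obtain ⟨E, hEs, hE0, hE1, hEU⟩ := hpush _ (hVU ht) _ (hVU ht')
    obtain ⟨θ, hθ⟩ := hVc.joinedIn t ht t' ht'
    have hgy : g y = α t := by
      have := hγ 1
      rw [δ.target, γ.target] at this
      exact this.symm
    let F : ℝ → C^∞⟮𝓡 n, N; 𝓡 m, M⟯ := fun s ↦
      ⟨fun x ↦ E s (g x), hEs.comp (contMDiff_const.prodMk g.contMDiff)⟩
    have hF : Continuous F := continuous_of_contMDiff_family
      (hEs.comp (contMDiff_fst.prodMk (g.contMDiff.comp contMDiff_snd)))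
    let γ' : Path g (F 1) :=
      { toFun := fun s ↦ F s
        continuous_toFun := hF.comp continuous_subtype_val
        source' := by
          ext x
          exact hE0 (g x)
        target' := by simp }
    let ε : Path (α t) (α t') :=
      { toFun := fun s ↦ E s (α t)
        continuous_toFun := hEs.continuous.comp
          (continuous_subtype_val.prodMk continuous_const)
        source' := by simpa using hE0 (α t)
        target' := by simpa using hE1 }
    refine ⟨F 1, γ.trans γ', δ.trans ε, η.trans θ, fun s ↦ ?_, ?_⟩
    · rw [Path.trans_apply, Path.trans_apply]
      split_ifs
      · exact hγ _
      · change E _ (α t) = E _ (g y)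
        rw [hgy]
    · have h1 : ε.Homotopic (θ.map α.continuous) :=
        hhom _ _ _ _ (fun s ↦ hEU s) fun s ↦ hVU (hθ s)
      have h2 := hδ.hcomp h1
      convert h2 using 1
      ext s
      simp only [Path.cast_coe, Path.map_coe, Function.comp_apply, Path.trans_apply]
      split_ifs <;> rfl
  have hQ : IsLocallyConstant Q := by
    refine (IsLocallyConstant.iff_eventually_eq _).2 fun τ ↦ ?_
    obtain ⟨V, hV, h⟩ := hstep τ
    filter_upwards [hV] with t ht
    exact propext ⟨h t ht τ (mem_of_mem_nhds hV), h τ (mem_of_mem_nhds hV) t ht⟩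
  have h0 : Q 0 := by
    refine ⟨f, Path.refl f, (Path.refl (f y)).cast rfl α.source, Path.refl 0, fun s ↦ rfl, ?_⟩
    convert Path.Homotopic.refl _ using 1
    ext s
    simp
  have h1 : Q 1 := by
    rw [← hQ.apply_eq_of_preconnectedSpace 0 1]
    exact h0
  obtain ⟨g, γ, δ, η, hγ, hδ⟩ := h1
  refine ⟨g, γ, δ.cast rfl α.target.symm, hγ, ?_⟩
  let ι : Path (0 : unitInterval) 1 := ⟨ContinuousMap.id _, rfl, rfl⟩
  have h2 := (SimplyConnectedSpace.paths_homotopic η ι).map ⟨α, α.continuous⟩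
  have h3 := (hδ.trans (h2.pathCast α.source.symm rfl)).pathCast rfl α.target.symm
  convert h3 using 1
  ext s
  rfl

end Push

/-! ### The double coset of a point of the incidence space -/

section Tracks

variable {n m : ℕ}
  {N : Type*} [TopologicalSpace N] [ChartedSpace (EuclideanSpace ℝ (Fin n)) N]
  {M : Type*} [TopologicalSpace M] [ChartedSpace (EuclideanSpace ℝ (Fin m)) M]

/-- A path `c` in `M` is a track from `(f, y)` to `(φ, ρ)` if it is of the form `s ↦ γ s (η s)`,
for a path `γ` of smooth maps from `f` to `φ` and a path `η` from `y` to `ρ`. -/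
def IsTrack (f φ : C^∞⟮𝓡 n, N; 𝓡 m, M⟯) (y ρ : N) {a b : M} (c : Path a b) : Prop :=
  ∃ (γ : Path f φ) (η : Path y ρ), ∀ s, c s = γ s (η s)

lemma IsTrack.trans {f φ χ : C^∞⟮𝓡 n, N; 𝓡 m, M⟯} {y ρ ζ : N} {a b d : M}
    {c : Path a b} {c' : Path b d}
    (h : IsTrack f φ y ρ c) (h' : IsTrack φ χ ρ ζ c') : IsTrack f χ y ζ (c.trans c') := by
  obtain ⟨γ, η, hc⟩ := h
  obtain ⟨γ', η', hc'⟩ := h'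
  refine ⟨γ.trans γ', η.trans η', fun s ↦ ?_⟩
  simp only [Path.trans_apply]
  split_ifs
  · exact hc _
  · exact hc' _

lemma IsTrack.symm {f φ : C^∞⟮𝓡 n, N; 𝓡 m, M⟯} {y ρ : N} {a b : M} {c : Path a b}
    (h : IsTrack f φ y ρ c) : IsTrack φ f ρ y c.symm := by
  obtain ⟨γ, η, hc⟩ := h
  exact ⟨γ.symm, η.symm, fun s ↦ hc _⟩

/-- A path of smooth maps, as a homotopy. -/
def smoothPathHomotopy [IsManifold (𝓡 n) ∞ N] [IsManifold (𝓡 m) ∞ M]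
    {f φ : C^∞⟮𝓡 n, N; 𝓡 m, M⟯} (γ : Path f φ) :
    (smoothToContinuous f).Homotopy (smoothToContinuous φ) where
  toFun q := γ q.1 q.2
  continuous_toFun := continuous_smoothMap_eval.comp
    ((γ.continuous.comp continuous_fst).prodMk continuous_snd)
  map_zero_left x := by
    change (γ 0) x = f x
    rw [γ.source]
  map_one_left x := by
    change (γ 1) x = φ x
    rw [γ.target]

/-- A loop that is a track from `(f, y)` to itself is the product of an element of the stabilizer
of `[f]` and an element of the image of `π₁(N, y)`: in `[0, 1] × N` the path `s ↦ (s, η s)` is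
homotopic to the concatenation of `s ↦ (s, y)` and `s ↦ (1, η s)`. -/
lemma IsTrack.mem_stabilizerImageSubgroup [IsManifold (𝓡 n) ∞ N] [IsManifold (𝓡 m) ∞ M]
    {f : C^∞⟮𝓡 n, N; 𝓡 m, M⟯} {y : N} {x₀ : M} (hf : smoothToContinuous f y = x₀)
    {c : Path x₀ x₀} (h : IsTrack f f y y c) :
    FundamentalGroup.fromPath (Path.Homotopic.Quotient.mk c) ∈
      stabilizerImageSubgroup (smoothToContinuous f) hf := by
  obtain ⟨γ, η, hc⟩ := h
  subst hf
  let H := smoothPathHomotopy γ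
  let ι : Path (0 : unitInterval) 1 := ⟨ContinuousMap.id _, rfl, rfl⟩
  have h1 : (ι.prod η).Homotopic ((ι.prod (Path.refl y)).trans ((Path.refl 1).prod η)) := by
    rw [Path.trans_prod_eq_prod_trans]
    exact ⟨Path.Homotopic.prodHomotopy (Path.Homotopic.trans_refl ι).symm.some
      (Path.Homotopic.refl_trans η).symm.some⟩
  have h2 := (h1.map H.toContinuousMap).pathCast (H.apply_zero y).symm (H.apply_one y).symm
  have h3 : c.Homotopic ((H.evalAt y).trans (η.map (smoothToContinuous f).continuous)) := by
    convert h2 using 1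
    · ext s
      exact hc s
    · ext s
      simp only [Path.cast_coe, Path.map_coe, Function.comp_apply, Path.trans_apply]
      split_ifs
      · rfl
      · exact (H.apply_one _).symm
  have h4 : Path.Homotopic.Quotient.mk c = (Path.Homotopic.Quotient.mk (H.evalAt y)).trans
      (Path.Homotopic.Quotient.mk (η.map (smoothToContinuous f).continuous)) :=
    Path.Homotopic.Quotient.eq.2 h3
  rw [h4]
  refine (stabilizerImageSubgroup (smoothToContinuous f) rfl).mul_mem
    (Subgroup.subset_closure (Or.inr ?_)) (Subgroup.subset_closure (Or.inl ⟨H, rfl⟩))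
  exact ⟨FundamentalGroup.fromPath (Path.Homotopic.Quotient.mk η),
    FundamentalGroup.mapOfEq_apply _ _ _⟩

end Tracks

section Invariant

variable {n₁ n₂ m : ℕ}
  {N₁ : Type*} [TopologicalSpace N₁] [ChartedSpace (EuclideanSpace ℝ (Fin n₁)) N₁]
  {N₂ : Type*} [TopologicalSpace N₂] [ChartedSpace (EuclideanSpace ℝ (Fin n₂)) N₂]
  {M : Type*} [TopologicalSpace M] [ChartedSpace (EuclideanSpace ℝ (Fin m)) M]

/-- The loop class `a` represents the point `(φ₁, φ₂, ρ₁, ρ₂)` if it is the class of `c₁ c₂⁻¹`,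
for a track `c₁` from `(f₁, y₁)` to `(φ₁, ρ₁)` and a track `c₂` from `(f₂, y₂)` to `(φ₂, ρ₂)`. -/
def Represents (f₁ : C^∞⟮𝓡 n₁, N₁; 𝓡 m, M⟯) (f₂ : C^∞⟮𝓡 n₂, N₂; 𝓡 m, M⟯) (y₁ : N₁) (y₂ : N₂)
    {x₀ : M} (b : C^∞⟮𝓡 n₁, N₁; 𝓡 m, M⟯ × C^∞⟮𝓡 n₂, N₂; 𝓡 m, M⟯ × N₁ × N₂)
    (a : FundamentalGroup M x₀) : Prop :=
  ∃ c₁ c₂ : Path x₀ (b.1 b.2.2.1), IsTrack f₁ b.1 y₁ b.2.2.1 c₁ ∧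
    IsTrack f₂ b.2.1 y₂ b.2.2.2 c₂ ∧
    a = FundamentalGroup.fromPath (Path.Homotopic.Quotient.mk (c₁.trans c₂.symm))

variable {f₁ : C^∞⟮𝓡 n₁, N₁; 𝓡 m, M⟯} {f₂ : C^∞⟮𝓡 n₂, N₂; 𝓡 m, M⟯} {y₁ : N₁} {y₂ : N₂} {x₀ : M}
  {b b' : C^∞⟮𝓡 n₁, N₁; 𝓡 m, M⟯ × C^∞⟮𝓡 n₂, N₂; 𝓡 m, M⟯ × N₁ × N₂}
  {a a' : FundamentalGroup M x₀}

/-- Two classes that represent the same point lie in the same double coset. -/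
lemma Represents.mk_eq [IsManifold (𝓡 n₁) ∞ N₁] [IsManifold (𝓡 n₂) ∞ N₂] [IsManifold (𝓡 m) ∞ M]
    (hf₁ : smoothToContinuous f₁ y₁ = x₀) (hf₂ : smoothToContinuous f₂ y₂ = x₀)
    (h : Represents f₁ f₂ y₁ y₂ b a) (h' : Represents f₁ f₂ y₁ y₂ b a') :
    DoubleCoset.mk (stabilizerImageSubgroup (smoothToContinuous f₂) hf₂)
        (stabilizerImageSubgroup (smoothToContinuous f₁) hf₁) a =
      DoubleCoset.mk _ _ a' := by
  obtain ⟨c₁, c₂, h1, h2, rfl⟩ := h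
  obtain ⟨c₁', c₂', h1', h2', rfl⟩ := h'
  refine (DoubleCoset.eq _ _ _ _).2 ⟨_, (h2.trans h2'.symm).mem_stabilizerImageSubgroup hf₂,
    _, (h1'.trans h1.symm).mem_stabilizerImageSubgroup hf₁, ?_⟩
  rw [FundamentalGroup.mul_def, FundamentalGroup.mul_def]
  change Path.Homotopic.Quotient.mk _ = (Path.Homotopic.Quotient.mk _).trans
    ((Path.Homotopic.Quotient.mk _).trans (Path.Homotopic.Quotient.mk _))
  simp only [Path.Homotopic.Quotient.mk_trans, Path.Homotopic.Quotient.mk_symm,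
    Path.Homotopic.Quotient.trans_assoc]
  rw [← Path.Homotopic.Quotient.trans_assoc (Path.Homotopic.Quotient.mk c₁).symm,
    Path.Homotopic.Quotient.symm_trans, Path.Homotopic.Quotient.refl_trans,
    ← Path.Homotopic.Quotient.trans_assoc (Path.Homotopic.Quotient.mk c₂).symm,
    Path.Homotopic.Quotient.symm_trans, Path.Homotopic.Quotient.refl_trans]

/-- The representing classes do not change along paths in the incidence space, since both tracks
are prolonged by the same path `s ↦ φ₁ˢ(ρ₁ˢ) = φ₂ˢ(ρ₂ˢ)`. -/
lemma Represents.of_joined [IsManifold (𝓡 n₁) ∞ N₁] [IsManifold (𝓡 m) ∞ M]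
    {𝒩₁ : Set C^∞⟮𝓡 n₁, N₁; 𝓡 m, M⟯} {𝒩₂ : Set C^∞⟮𝓡 n₂, N₂; 𝓡 m, M⟯}
    {b b' : incidenceSpace 𝒩₁ 𝒩₂} (hb : Joined b b')
    (h : Represents f₁ f₂ y₁ y₂ b.1 a) : Represents f₁ f₂ y₁ y₂ b'.1 a := by
  obtain ⟨β⟩ := hb
  obtain ⟨c₁, c₂, h1, h2, rfl⟩ := h
  let β' := β.map continuous_subtype_val
  let ev : C(C^∞⟮𝓡 n₁, N₁; 𝓡 m, M⟯ × C^∞⟮𝓡 n₂, N₂; 𝓡 m, M⟯ × N₁ × N₂, M) :=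
    ⟨fun b ↦ b.1 b.2.2.1, continuous_smoothMap_eval.comp
      (continuous_fst.prodMk (continuous_fst.comp (continuous_snd.comp continuous_snd)))⟩
  let q := β'.map ev.continuous
  have hq1 : IsTrack b.1.1 b'.1.1 b.1.2.2.1 b'.1.2.2.1 q :=
    ⟨β'.map continuous_fst, β'.map (continuous_fst.comp (continuous_snd.comp continuous_snd)),
      fun s ↦ rfl⟩
  have hq2 : IsTrack b.1.2.1 b'.1.2.1 b.1.2.2.2 b'.1.2.2.2 q :=
    ⟨β'.map (continuous_fst.comp continuous_snd),
      β'.map (continuous_snd.comp (continuous_snd.comp continuous_snd)),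
      fun s ↦ (β s).2.2.2⟩
  refine ⟨c₁.trans q, c₂.trans q, h1.trans hq1, h2.trans hq2, ?_⟩
  change Path.Homotopic.Quotient.mk _ = Path.Homotopic.Quotient.mk _
  simp only [Path.Homotopic.Quotient.mk_trans, Path.Homotopic.Quotient.mk_symm,
    Path.trans_symm, Path.Homotopic.Quotient.trans_assoc]
  rw [← Path.Homotopic.Quotient.trans_assoc (Path.Homotopic.Quotient.mk q),
    Path.Homotopic.Quotient.trans_symm, Path.Homotopic.Quotient.refl_trans]

lemma exists_represents [IsManifold (𝓡 n₁) ∞ N₁] [IsManifold (𝓡 n₂) ∞ N₂] [IsManifold (𝓡 m) ∞ M]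
    [PathConnectedSpace N₁] [PathConnectedSpace N₂]
    (hf₁ : smoothToContinuous f₁ y₁ = x₀) (hf₂ : smoothToContinuous f₂ y₂ = x₀)
    (hb : b ∈ incidenceSpace (pathComponent f₁) (pathComponent f₂)) :
    ∃ a : FundamentalGroup M x₀, Represents f₁ f₂ y₁ y₂ b a := by
  obtain ⟨φ₁, φ₂, ρ₁, ρ₂⟩ := b
  obtain ⟨⟨γ₁⟩, ⟨γ₂⟩, he⟩ := hb
  obtain ⟨η₁⟩ := PathConnectedSpace.joined y₁ ρ₁
  obtain ⟨η₂⟩ := PathConnectedSpace.joined y₂ ρ₂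
  change Path f₁ φ₁ at γ₁
  change Path f₂ φ₂ at γ₂
  change φ₁ ρ₁ = φ₂ ρ₂ at he
  let c₁ : Path x₀ (φ₁ ρ₁) :=
    { toFun := fun s ↦ γ₁ s (η₁ s)
      continuous_toFun := continuous_smoothMap_eval.comp (γ₁.continuous.prodMk η₁.continuous)
      source' := by
        rw [γ₁.source, η₁.source]
        exact hf₁
      target' := by simp }
  let c₂ : Path x₀ (φ₁ ρ₁) :=
    { toFun := fun s ↦ γ₂ s (η₂ s)
      continuous_toFun := continuous_smoothMap_eval.comp (γ₂.continuous.prodMk η₂.continuous)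
      source' := by
        rw [γ₂.source, η₂.source]
        exact hf₂
      target' := by simp [he] }
  exact ⟨_, c₁, c₂, ⟨γ₁, η₁, fun _ ↦ rfl⟩, ⟨γ₂, η₂, fun _ ↦ rfl⟩, rfl⟩

/-- Every class represents a point of the incidence space: push `f₁` along a loop in the class,
and leave `f₂` and the base points in place. -/
lemma exists_mem_incidenceSpace_represents [IsManifold (𝓡 m) ∞ M] [T2Space M]
    (hf₁ : smoothToContinuous f₁ y₁ = x₀) (hf₂ : smoothToContinuous f₂ y₂ = x₀)
    (a : FundamentalGroup M x₀) :
    ∃ b ∈ incidenceSpace (pathComponent f₁) (pathComponent f₂), Represents f₁ f₂ y₁ y₂ b a := by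
  obtain ⟨α, rfl⟩ := Path.Homotopic.Quotient.mk_surjective a
  obtain ⟨g, γ, δ, hδ, hδα⟩ := exists_path_smoothMap f₁ y₁ (α.cast hf₁ rfl)
  have hg : g y₁ = x₀ := by
    have := hδ 1
    rw [δ.target, γ.target] at this
    exact this.symm
  refine ⟨(g, f₂, y₁, y₂), ⟨⟨γ⟩, mem_pathComponent_self f₂, hg.trans hf₂.symm⟩,
    δ.cast hf₁.symm hg, (Path.refl x₀).cast rfl hg, ⟨γ, Path.refl y₁, hδ⟩,
    ⟨Path.refl f₂, Path.refl y₂, fun s ↦ hf₂.symm⟩, ?_⟩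
  refine Path.Homotopic.Quotient.eq.2 ?_
  have h1 := (hδα.pathCast hf₁.symm rfl).symm
  have h2 := h1.trans (Path.Homotopic.trans_refl _).symm
  convert h2 using 1
  · ext s
    rfl
  · ext s
    simp only [Path.trans_apply]
    split_ifs <;> rfl

end Invariant

/-! ### Infinitely many components and the bordism group -/

theorem mainTheorem8 {n₁ n₂ m : ℕ}
    {N₁ : Type*} [TopologicalSpace N₁] [ChartedSpace (EuclideanSpace ℝ (Fin n₁)) N₁]
    [IsManifold (𝓡 n₁) ∞ N₁] [T2Space N₁] [CompactSpace N₁] [ConnectedSpace N₁]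
    {N₂ : Type*} [TopologicalSpace N₂] [ChartedSpace (EuclideanSpace ℝ (Fin n₂)) N₂]
    [IsManifold (𝓡 n₂) ∞ N₂] [T2Space N₂] [CompactSpace N₂] [ConnectedSpace N₂]
    {M : Type*} [TopologicalSpace M] [ChartedSpace (EuclideanSpace ℝ (Fin m)) M]
    [IsManifold (𝓡 m) ∞ M] [T2Space M] [SecondCountableTopology M] [ConnectedSpace M]
    (y₁ : N₁) (y₂ : N₂) (x₀ : M)
    (f₁ : C^∞⟮𝓡 n₁, N₁; 𝓡 m, M⟯) (f₂ : C^∞⟮𝓡 n₂, N₂; 𝓡 m, M⟯)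
    (hf₁ : smoothToContinuous f₁ y₁ = x₀) (hf₂ : smoothToContinuous f₂ y₂ = x₀)
    (𝒩₁ : Set C^∞⟮𝓡 n₁, N₁; 𝓡 m, M⟯) (h𝒩₁ : 𝒩₁ = pathComponent f₁)
    (𝒩₂ : Set C^∞⟮𝓡 n₂, N₂; 𝓡 m, M⟯) (h𝒩₂ : 𝒩₂ = pathComponent f₂)
    (G₁ G₂ : Subgroup (FundamentalGroup M x₀))
    (hG₁ : G₁ = stabilizerImageSubgroup (smoothToContinuous f₁) hf₁)
    (hG₂ : G₂ = stabilizerImageSubgroup (smoothToContinuous f₂) hf₂)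
    (hinf : Infinite (DoubleCoset.Quotient (G₂ : Set (FundamentalGroup M x₀))
      (G₁ : Set (FundamentalGroup M x₀)))) :
    Infinite (ZerothHomotopy (incidenceSpace 𝒩₁ 𝒩₂)) ∧
      ¬ AddGroup.FG (BordismZero (incidenceSpace 𝒩₁ 𝒩₂)) := by
  subst h𝒩₁ h𝒩₂ hG₁ hG₂
  have : LocallyPathConnectedSpace N₁ :=
    ChartedSpace.locallyPathConnectedSpace (EuclideanSpace ℝ (Fin n₁)) N₁
  have : LocallyPathConnectedSpace N₂ :=
    ChartedSpace.locallyPathConnectedSpace (EuclideanSpace ℝ (Fin n₂)) N₂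
  have : PathConnectedSpace N₁ := pathConnectedSpace_iff_connectedSpace.2 inferInstance
  have : PathConnectedSpace N₂ := pathConnectedSpace_iff_connectedSpace.2 inferInstance
  have hex : ∀ b : incidenceSpace (pathComponent f₁) (pathComponent f₂),
      ∃ a : FundamentalGroup M x₀, Represents f₁ f₂ y₁ y₂ b.1 a :=
    fun b ↦ exists_represents hf₁ hf₂ b.2
  choose r hr using hex
  let Φ : ZerothHomotopy (incidenceSpace (pathComponent f₁) (pathComponent f₂)) →
      DoubleCoset.Quotient
        (stabilizerImageSubgroup (smoothToContinuous f₂) hf₂ : Set (FundamentalGroup M x₀))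
        (stabilizerImageSubgroup (smoothToContinuous f₁) hf₁) :=
    Quotient.lift (fun b ↦ DoubleCoset.mk _ _ (r b)) fun b b' h ↦
      ((hr b).of_joined h).mk_eq hf₁ hf₂ (hr b')
  have hΦ : Function.Surjective Φ := by
    intro d
    obtain ⟨a, rfl⟩ := Quotient.exists_rep d
    obtain ⟨b, hb, hba⟩ := exists_mem_incidenceSpace_represents hf₁ hf₂ a
    exact ⟨ZerothHomotopy.mk ⟨b, hb⟩, (hr ⟨b, hb⟩).mk_eq hf₁ hf₂ hba⟩
  have hpi : Infinite (ZerothHomotopy (incidenceSpace (pathComponent f₁) (pathComponent f₂))) :=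
    Infinite.of_surjective Φ hΦ
  exact ⟨hpi, BordismZero.not_fg⟩

end
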